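/- For $r\in{]0,1[}$ put $\alpha=\frac{1+r}{2}$ and $$P_1=\begin{pmatrix}-r&r\alpha&0\\-\alpha&\alpha^2-r&r\alpha\\0&0&r^2\end{pmatrix},\quad P_2=\begin{pmatrix}r&-r\alpha&0\\\alpha&-2\alpha^2+r&\alpha\\0&-r\alpha&r\end{pmatrix},\quad P_3=\begin{pmatrix}r^2&0&0\\r\alpha&\alpha^2-r&-\alpha\\0&r\alpha&-r\end{pmatrix},\quad J=\begin{pmatrix}0&0&1\\0&1&0\\1&0&0\end{pmatrix}.$$ Consider four identical inelastic point particles on the line with restitution coefficient $r$; denote by $\mathfrak a,\mathfrak b,\mathfrak c$ the collisions of the pairs $1$-$2$, $2$-$3$, $3$-$4$. The $\mathfrak b$-to-$\mathfrak b$ mapping describes how the normal vector $u=(x,y,z)$ of the plane spanned by the relative positions and the relative velocities evolves from one collision $\mathfrak b$ to the next. It acts on $X=\{u\in\mathbb S^2: x\ge0,\ z\le0\}\cup\{u\in\mathbb S^2: x\le0,\ z\ge0\}$ as follows: replace $u$ by $-u$ if necessary so that $x\ge 0$, $z\le0$, and put $\widehat{\mathfrak P}_r(u)=P_iu/|P_iu|$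 with $i=1$ if $y>0$ and $\alpha y-x>0$ (collisions $\mathfrak{ab}$), $i=3$ if $y<0$ and $\alpha y-z<0$ (collisions $\mathfrak{cb}$), and $i=2$ otherwise (collisions $\mathfrak{acb}$ or $\mathfrak{cab}$). A point $u\in X$ generates the periodic orbit $132312$ if $\widehat{\mathfrak P}_r^{\,6}(u)=u$ and if $i$ takes successively the values $1,3,2,3,1,2$ at $u,\widehat{\mathfrak P}_r(u),\dots,\widehat{\mathfrak P}_r^{\,5}(u)$. **Theorem.** For every $r\in{]0,1[}$ the matrix $JP_2P_3P_1$ has a unique dominating eigenvalue, that is, a real simple eigenvalue whose modulus is strictly larger than that of all its other complex eigenvalues. Among the $r\in{]0,1[}$ for which it exists, let $u=u(r)$ be an associated eigenvector with $u_x=1$. The equation $\alpha u_y-u_x=0$ has exactly one root $r_{\mathrm{crit}}$ in $]0,1[$; it satisfies $|r_{\mathrm{crit}}-0.22006978614631047521|<10^{-20}$, and in particular $r_{\mathrm{crit}}>3-2\sqrt2$ and $r_{\mathrm{crit}}>0.1918$. For every $r\in{]r_{\mathrm{crit}},1[}$, the eigenvector $u$ with $u_x=1$ exists and is unique, and $u/|u|$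 is the single point of $X$ that generates the periodic orbit $132312$. The collisions of the particles along this orbit are those indicated by the pattern ($1=\mathfrak{ab}$, $3=\mathfrak{cb}$, $2=\mathfrak{acb}$ or $\mathfrak{cab}$). The orbit is locally stable: orbits of $\widehat{\mathfrak P}_r$ starting at points of $X$ close enough to $u/|u|$ remain arbitrarily close to the orbit of $u/|u|$ for all times and converge to it. -/

import Mathlib

open Set Filter Topology
open scoped Matrix

namespace FourSpheres

noncomputable section

/-- Vectors of `ℝ³`, with coordinates `u 0 = u_x`, `u 1 = u_y`, `u 2 = u_z`.
The Euclidean norm on them is `norm2` below (not the sup norm of the function type). -/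
abbrev Vec : Type := Fin 3 → ℝ

/-- The Euclidean norm of `ℝ³`. -/
def norm2 (u : Vec) : ℝ := √(u ⬝ᵥ u)

/-- The Euclidean normalization `u / |u|`. -/
def toSphere (u : Vec) : Vec := (norm2 u)⁻¹ • u

/-- `α = (1 + r) / 2`. -/
def alpha (r : ℝ) : ℝ := (r + 1) / 2

/-! ### The collision matrices and the piecewise linear mapping -/

def P1 (r : ℝ) : Matrix (Fin 3) (Fin 3) ℝ :=
  !![-r, r * alpha r, 0;
     -alpha r, alpha r ^ 2 - r, r * alpha r;
     0, 0, r ^ 2]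

def P2 (r : ℝ) : Matrix (Fin 3) (Fin 3) ℝ :=
  !![r, -(r * alpha r), 0;
     alpha r, -(2 * alpha r ^ 2) + r, alpha r;
     0, -(r * alpha r), r]

def P3 (r : ℝ) : Matrix (Fin 3) (Fin 3) ℝ :=
  !![r ^ 2, 0, 0;
     r * alpha r, alpha r ^ 2 - r, -alpha r;
     0, r * alpha r, -r]

def J : Matrix (Fin 3) (Fin 3) ℝ :=
  !![0, 0, 1;
     0, 1, 0;
     1, 0, 0]

/-- The three letters used to encode orbits. -/
inductive Block
  | one
  | two
  | three
  deriving DecidableEq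

def Block.matrix (r : ℝ) : Block → Matrix (Fin 3) (Fin 3) ℝ
  | .one => P1 r
  | .two => P2 r
  | .three => P3 r

/-- The domain `X` of the `b`-to-`b` mapping: unit vectors with `x ≥ 0, z ≤ 0` or
`x ≤ 0, z ≥ 0`. -/
def domX : Set Vec :=
  {u | u 0 ^ 2 + u 1 ^ 2 + u 2 ^ 2 = 1 ∧ ((0 ≤ u 0 ∧ u 2 ≤ 0) ∨ (u 0 ≤ 0 ∧ 0 ≤ u 2))}

/-- `u` and `-u` are normal to the same plane; choose the representative in the quadrant
`x ≥ 0, z ≤ 0`. -/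
def orient (u : Vec) : Vec := by
  classical exact if 0 ≤ u 0 ∧ u 2 ≤ 0 then u else -u

/-- The letter of a vector `u` of the quadrant `x ≥ 0, z ≤ 0`: which of the matrices
`P₁, P₂, P₃` the piecewise linear mapping applies at `u`. On the sets `αy = x` and `αy = z`
(triple collisions) and `y = 0` (where the collisions `a` and `c` are simultaneous), the matrix
is `P₂`. -/
def letter (r : ℝ) (u : Vec) : Block := by
  classical exact
    if 0 < u 1 ∧ 0 < alpha r * u 1 - u 0 then .one
    else if u 1 < 0 ∧ alpha r * u 1 - u 2 < 0 then .three
    else .two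

/-- The letter of a point of the domain `X`. -/
def code (r : ℝ) (u : Vec) : Block := letter r (orient u)

/-- The `b`-to-`b` mapping, as a normalized piecewise linear mapping of `X`; see
`bMap_eq_collisions` below for its description in terms of collisions. -/
def bMap (r : ℝ) (u : Vec) : Vec :=
  toSphere ((code r u).matrix r *ᵥ orient u)

/-! ### The collisions behind the `b`-to-`b` mapping -/

/-- The types of collisions: `a` (particles 1-2), `b` (particles 2-3), `c` (particles 3-4). -/
inductive Contact
  | a
  | b
  | c
  deriving DecidableEq

/-- The unit normal of the plane on which the given pair is in contact. -/
def Contact.axis : Contact → Vec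
  | .a => ![1, 0, 0]
  | .b => ![0, 1, 0]
  | .c => ![0, 0, 1]

/-- The action of a collision on the relative velocities. -/
def Contact.matrix (r : ℝ) : Contact → Matrix (Fin 3) (Fin 3) ℝ
  | .a => !![-r, 0, 0; alpha r, 1, 0; 0, 0, 1]
  | .b => !![1, alpha r, 0; 0, -r, 0; 0, alpha r, 1]
  | .c => !![1, 0, 0; 0, 1, alpha r; 0, 0, -r]

/-- The cyclic order `a → b → c → a`. -/
def Contact.succ : Contact → Contact
  | .a => .b
  | .b => .c
  | .c => .a

/-- The cyclic order reversed. -/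
def Contact.pred : Contact → Contact
  | .a => .c
  | .b => .a
  | .c => .b

/-- Relative velocities right after a collision of type `k`, in the plane normal to `u`:
`q = p ∧ u` with `p = u ∧ e_k`. -/
def velocity (k : Contact) (u : Vec) : Vec :=
  crossProduct (crossProduct u k.axis) u

/-- `q · v` with `v = u - (u · e_k) e_k`; its sign decides the next collision. -/
def discriminator (k : Contact) (u : Vec) : ℝ :=
  velocity k u ⬝ᵥ (u - (u ⬝ᵥ k.axis) • k.axis)

/-- The type of the collision that follows a collision of type `k` in the plane normal to `u`
(`none` if it is not determined). -/
def nextContact (k : Contact) (u : Vec) : Option Contact := by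
  classical exact
    if 0 < discriminator k u then some k.succ
    else if discriminator k u < 0 then some k.pred
    else none

/-- The normal vector `q' ∧ p'` after the next collision, of type `k'`, where `q' = K q` and
`p' = e_{k'} ∧ u`. -/
def afterCollision (r : ℝ) (k k' : Contact) (u : Vec) : Vec :=
  crossProduct (k'.matrix r *ᵥ velocity k u) (crossProduct k'.axis u)

/-- Follow the collisions, at most `n` of them, until the first collision of type `b`; returns the
word of the collisions and the final normal vector. -/
def runToB (r : ℝ) : ℕ → Contact → Vec → Option (List Contact × Vec)
  | 0, _, _ => none
  | n + 1, k, u =>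
    (nextContact k u).bind fun k' =>
      if k' = .b then some ([k'], afterCollision r k k' u)
      else (runToB r n k' (afterCollision r k k' u)).map fun p => (k' :: p.1, p.2)

/-- The collisions from one collision of type `b` to the next one, starting with the plane normal
to `u` (at most three collisions are needed). -/
def bToB (r : ℝ) (u : Vec) : Option (List Contact × Vec) := runToB r 3 .b (orient u)

/-- The collision words denoted by a letter: `1` is `ab`, `3` is `cb`, and `2` is, indistinctly,
`acb` or `cab`. -/
def Block.words : Block → Set (List Contact)
  | .one => {[.a, .b]}
  | .two => {[.a, .c, .b], [.c, .a, .b]}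
  | .three => {[.c, .b]}

/-! ### Consistency: away from the degenerate configurations, the `b`-to-`b` mapping is the result
of the collisions -/

theorem toSphere_smul {k : ℝ} (hk : 0 < k) (v : Vec) : toSphere (k • v) = toSphere v := by
  have h : norm2 (k • v) = k * norm2 v := by
    unfold norm2
    rw [smul_dotProduct, dotProduct_smul, smul_eq_mul, smul_eq_mul, ← mul_assoc,
      Real.sqrt_mul (by positivity), Real.sqrt_mul_self hk.le]
  unfold toSphere
  rw [h, smul_smul, mul_inv, mul_comm k⁻¹, mul_assoc, inv_mul_cancel₀ hk.ne', mul_one]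

theorem discriminator_a (x y z : ℝ) :
    discriminator .a ![x, y, z] = -(x * (y ^ 2 + z ^ 2)) := by
  simp [discriminator, velocity, Contact.axis, crossProduct, dotProduct, Fin.sum_univ_three]
  ring

theorem discriminator_b (x y z : ℝ) :
    discriminator .b ![x, y, z] = -(y * (x ^ 2 + z ^ 2)) := by
  simp [discriminator, velocity, Contact.axis, crossProduct, dotProduct, Fin.sum_univ_three]
  ring

theorem discriminator_c (x y z : ℝ) :
    discriminator .c ![x, y, z] = -(z * (x ^ 2 + y ^ 2)) := by
  simp [discriminator, velocity, Contact.axis, crossProduct, dotProduct, Fin.sum_univ_three]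
  ring

theorem nextContact_pos {k : Contact} {u : Vec} (h : 0 < discriminator k u) :
    nextContact k u = some k.succ := by
  simp [nextContact, h]

theorem nextContact_neg {k : Contact} {u : Vec} (h : discriminator k u < 0) :
    nextContact k u = some k.pred := by
  simp [nextContact, h, not_lt.2 h.le]

theorem after_ba (r x y z : ℝ) : afterCollision r .b .a ![x, y, z] =
    (x * y) • ![x - alpha r * y, -(r * y), -(r * z)] := by
  ext i
  fin_cases i
  all_goals
    simp only [afterCollision, velocity, Contact.axis, Contact.matrix, cross_apply]
    simp [Matrix.mulVec, Matrix.vecHead, Matrix.vecTail]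
    try ring

theorem after_bc (r x y z : ℝ) : afterCollision r .b .c ![x, y, z] =
    (y * z) • ![-(r * x), -(r * y), z - alpha r * y] := by
  ext i
  fin_cases i
  all_goals
    simp only [afterCollision, velocity, Contact.axis, Contact.matrix, cross_apply]
    simp [Matrix.mulVec, Matrix.vecHead, Matrix.vecTail]
    try ring

theorem after_ab (r x y z : ℝ) : afterCollision r .a .b ![x, y, z] =
    (x * y) • ![-(r * x), y - alpha r * (x + z), -(r * z)] := by
  ext i
  fin_cases i
  all_goals
    simp only [afterCollision, velocity, Contact.axis, Contact.matrix, cross_apply]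
    simp [Matrix.mulVec, Matrix.vecHead, Matrix.vecTail]
    try ring

theorem after_cb (r x y z : ℝ) : afterCollision r .c .b ![x, y, z] =
    (y * z) • ![-(r * x), y - alpha r * (x + z), -(r * z)] := by
  ext i
  fin_cases i
  all_goals
    simp only [afterCollision, velocity, Contact.axis, Contact.matrix, cross_apply]
    simp [Matrix.mulVec, Matrix.vecHead, Matrix.vecTail]
    try ring

theorem after_ac (r x y z : ℝ) : afterCollision r .a .c ![x, y, z] =
    (x * z) • ![-(r * x), -(r * y), z - alpha r * y] := by
  ext i
  fin_cases i
  all_goals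
    simp only [afterCollision, velocity, Contact.axis, Contact.matrix, cross_apply]
    simp [Matrix.mulVec, Matrix.vecHead, Matrix.vecTail]
    try ring

theorem after_ca (r x y z : ℝ) : afterCollision r .c .a ![x, y, z] =
    (x * z) • ![x - alpha r * y, -(r * y), -(r * z)] := by
  ext i
  fin_cases i
  all_goals
    simp only [afterCollision, velocity, Contact.axis, Contact.matrix, cross_apply]
    simp [Matrix.mulVec, Matrix.vecHead, Matrix.vecTail]
    try ring

theorem smul_vec3 (k x y z : ℝ) : k • (![x, y, z] : Vec) = ![k * x, k * y, k * z] := by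
  simp

theorem P1_mulVec (r x y z : ℝ) : P1 r *ᵥ ![x, y, z] =
    ![r * (alpha r * y - x), alpha r * (alpha r * y - x) - r * y + r * alpha r * z,
      r ^ 2 * z] := by
  ext i
  fin_cases i <;> simp [P1, Matrix.mulVec, Matrix.vecHead, Matrix.vecTail] <;> ring

theorem P2_mulVec (r x y z : ℝ) : P2 r *ᵥ ![x, y, z] =
    ![-(r * (alpha r * y - x)),
      -(alpha r * (alpha r * y - x)) - alpha r * (alpha r * y - z) + r * y,
      -(r * (alpha r * y - z))] := by
  ext i
  fin_cases i <;> simp [P2, Matrix.mulVec, Matrix.vecHead, Matrix.vecTail] <;> ring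

theorem P3_mulVec (r x y z : ℝ) : P3 r *ᵥ ![x, y, z] =
    ![r ^ 2 * x, alpha r * (alpha r * y - z) - r * y + r * alpha r * x,
      r * (alpha r * y - z)] := by
  ext i
  fin_cases i <;> simp [P3, Matrix.mulVec, Matrix.vecHead, Matrix.vecTail] <;> ring

theorem runToB_quadrant {r x y z : ℝ} (hr : 0 < r) (hx : 0 < x) (hz : z < 0) (hy : y ≠ 0)
    (h1 : alpha r * y - x ≠ 0) (h2 : alpha r * y - z ≠ 0) :
    ∃ w ∈ (letter r ![x, y, z]).words, ∃ k : ℝ, 0 < k ∧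
      runToB r 3 .b ![x, y, z] =
        some (w, k • ((letter r ![x, y, z]).matrix r *ᵥ ![x, y, z])) := by
  have ha : 0 < alpha r := by unfold alpha; linarith
  rcases lt_or_gt_of_ne hy with hy | hy
  · have e1 : nextContact .b ![x, y, z] = some .c :=
      nextContact_pos (by rw [discriminator_b]; nlinarith [mul_pos hx hx, sq_nonneg z])
    have hK : 0 < y * z := mul_pos_of_neg_of_neg hy hz
    set K := y * z with hKdef
    have hyx : alpha r * y - x < 0 := by nlinarith
    have hry : 0 < -(r * y) := by nlinarith
    have hX : 0 < K * (r * x) := by positivity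
    have hs : 0 < (K * -(r * x)) ^ 2 + (K * -(r * y)) ^ 2 := by
      have : K * -(r * x) ≠ 0 := by linarith
      positivity
    rcases lt_or_gt_of_ne h2 with h2 | h2
    · have hl : letter r ![x, y, z] = .three := by
        simp [letter, hy, not_lt.2 hy.le]; linarith
      have hZ : 0 < z - alpha r * y := by linarith
      have e2 : nextContact .c (K • ![-(r * x), -(r * y), z - alpha r * y]) = some .b := by
        rw [smul_vec3]
        refine nextContact_neg ?_
        rw [discriminator_c]
        have := mul_pos (mul_pos hK hZ) hs
        linarith
      refine ⟨[.c, .b], by simp [hl, Block.words],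
        K ^ 3 * (-(r * y) * (z - alpha r * y)), by positivity, ?_⟩
      simp only [runToB, e1, Option.bind_some, after_bc, ← hKdef, e2, reduceCtorEq, if_false,
        if_true, Option.map_some, hl, Block.matrix, P3_mulVec]
      rw [smul_vec3, after_cb, smul_vec3, smul_vec3]
      congr 2
      ext i
      fin_cases i <;> simp <;> ring
    · have hl : letter r ![x, y, z] = .two := by
        simp [letter, not_lt.2 hy.le]; intro; linarith
      have hZ : 0 < alpha r * y - z := by linarith
      have e2 : nextContact .c (K • ![-(r * x), -(r * y), z - alpha r * y]) = some .a := by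
        rw [smul_vec3]
        refine nextContact_pos ?_
        rw [discriminator_c]
        have := mul_pos (mul_pos hK hZ) hs
        nlinarith
      set L := K ^ 3 * ((r * x) * (alpha r * y - z)) with hLdef
      have hL : 0 < L := by positivity
      have e3 : afterCollision r .c .a (K • ![-(r * x), -(r * y), z - alpha r * y]) =
          L • ![r * (alpha r * y - x), r * (r * y), r * (alpha r * y - z)] := by
        have : -(r * x) - alpha r * -(r * y) = r * (alpha r * y - x) := by ring
        rw [smul_vec3, after_ca, smul_vec3, smul_vec3]
        ext i
        fin_cases i <;> simp [hLdef] <;> ring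
      have e4 : nextContact .a
          (L • ![r * (alpha r * y - x), r * (r * y), r * (alpha r * y - z)]) = some .b := by
        rw [smul_vec3]
        refine nextContact_pos ?_
        rw [discriminator_a]
        have h3 : 0 < (L * (r * (alpha r * y - z))) ^ 2 := by positivity
        have h4 : 0 < L * (r * (x - alpha r * y)) :=
          mul_pos hL (mul_pos hr (by linarith))
        have := mul_pos h4 (add_pos_of_nonneg_of_pos (sq_nonneg (L * (r * (r * y)))) h3)
        linarith
      have hk : 0 < (x - alpha r * y) * (-(r * y)) := mul_pos (by linarith) hry
      refine ⟨[.c, .a, .b], by simp [hl, Block.words],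
        L ^ 3 * r ^ 3 * ((x - alpha r * y) * (-(r * y))), by positivity, ?_⟩
      simp only [runToB, e1, Option.bind_some, after_bc, ← hKdef, e2, e3, e4, reduceCtorEq,
        if_false, if_true, Option.map_some, hl, Block.matrix, P2_mulVec]
      rw [smul_vec3 L, after_ab, smul_vec3, smul_vec3]
      congr 2
      ext i
      fin_cases i <;> simp <;> ring
  · have e1 : nextContact .b ![x, y, z] = some .a :=
      nextContact_neg (by rw [discriminator_b]; nlinarith [mul_pos hx hx, sq_nonneg z])
    have hK : 0 < x * y := mul_pos hx hy
    set K := x * y with hKdef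
    have hyz : 0 < alpha r * y - z := by nlinarith
    have hrz : 0 < -(r * z) := by nlinarith
    have hs : 0 < (K * -(r * y)) ^ 2 + (K * -(r * z)) ^ 2 := by positivity
    rcases lt_or_gt_of_ne h1 with h1 | h1
    · have hl : letter r ![x, y, z] = .two := by
        simp [letter, not_lt.2 hy.le]; intro; linarith
      have hX : 0 < x - alpha r * y := by linarith
      have e2 : nextContact .a (K • ![x - alpha r * y, -(r * y), -(r * z)]) = some .c := by
        rw [smul_vec3]
        refine nextContact_neg ?_
        rw [discriminator_a]
        have := mul_pos (mul_pos hK hX) hs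
        linarith
      set L := K ^ 3 * ((x - alpha r * y) * (-(r * z))) with hLdef
      have hL : 0 < L := by positivity
      have e3 : afterCollision r .a .c (K • ![x - alpha r * y, -(r * y), -(r * z)]) =
          L • ![r * (alpha r * y - x), r * (r * y), r * (alpha r * y - z)] := by
        rw [smul_vec3, after_ac, smul_vec3, smul_vec3]
        ext i
        fin_cases i <;> simp [hLdef] <;> ring
      have e4 : nextContact .c
          (L • ![r * (alpha r * y - x), r * (r * y), r * (alpha r * y - z)]) = some .b := by
        rw [smul_vec3]
        refine nextContact_neg ?_
        rw [discriminator_c]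
        have h3 : 0 < (L * (r * (r * y))) ^ 2 := by positivity
        have h4 : 0 < L * (r * (alpha r * y - z)) := by positivity
        have := mul_pos h4
          (add_pos_of_nonneg_of_pos (sq_nonneg (L * (r * (alpha r * y - x)))) h3)
        linarith
      refine ⟨[.a, .c, .b], by simp [hl, Block.words],
        L ^ 3 * r ^ 4 * ((alpha r * y - z) * y), by positivity, ?_⟩
      simp only [runToB, e1, Option.bind_some, after_ba, ← hKdef, e2, e3, e4, reduceCtorEq,
        if_false, if_true, Option.map_some, hl, Block.matrix, P2_mulVec]
      rw [smul_vec3 L, after_cb, smul_vec3, smul_vec3]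
      congr 2
      ext i
      fin_cases i <;> simp <;> ring
    · have hl : letter r ![x, y, z] = .one := by
        unfold letter
        exact if_pos ⟨hy, h1⟩
      have hX : 0 < alpha r * y - x := by linarith
      have e2 : nextContact .a (K • ![x - alpha r * y, -(r * y), -(r * z)]) = some .b := by
        rw [smul_vec3]
        refine nextContact_pos ?_
        rw [discriminator_a]
        have := mul_pos (mul_pos hK hX) hs
        nlinarith
      refine ⟨[.a, .b], by simp [hl, Block.words],
        K ^ 3 * ((r * y) * (alpha r * y - x)), by positivity, ?_⟩
      simp only [runToB, e1, Option.bind_some, after_ba, ← hKdef, e2, reduceCtorEq, if_false,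
        if_true, Option.map_some, hl, Block.matrix, P1_mulVec]
      rw [smul_vec3, after_ab, smul_vec3, smul_vec3]
      congr 2
      ext i
      fin_cases i <;> simp <;> ring

/-- Away from the degenerate configurations, `bMap` is the normalized result of the collisions,
and the letter of a point tells which collisions occur. -/
theorem bMap_eq_collisions {r : ℝ} (hr : 0 < r) {u : Vec} (hu : u ∈ domX)
    (hx : u 0 ≠ 0) (hy : u 1 ≠ 0) (hz : u 2 ≠ 0)
    (h1 : alpha r * u 1 - u 0 ≠ 0) (h2 : alpha r * u 1 - u 2 ≠ 0) :
    ∃ w ∈ (code r u).words, ∃ u' : Vec, bToB r u = some (w, u') ∧ toSphere u' = bMap r u := by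
  obtain ⟨x, y, z, ho, hx', hz', hy', h1', h2'⟩ : ∃ x y z : ℝ, orient u = ![x, y, z] ∧
      0 < x ∧ z < 0 ∧ y ≠ 0 ∧ alpha r * y - x ≠ 0 ∧ alpha r * y - z ≠ 0 := by
    by_cases h : 0 ≤ u 0 ∧ u 2 ≤ 0
    · refine ⟨u 0, u 1, u 2, ?_, lt_of_le_of_ne h.1 hx.symm, lt_of_le_of_ne h.2 hz, hy, h1, h2⟩
      ext i
      fin_cases i <;> simp [orient, h]
    · have h' : u 0 ≤ 0 ∧ 0 ≤ u 2 := hu.2.resolve_left h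
      refine ⟨-u 0, -u 1, -u 2, ?_, neg_pos.2 (lt_of_le_of_ne h'.1 hx),
        neg_neg_of_pos (lt_of_le_of_ne h'.2 hz.symm), neg_ne_zero.2 hy, ?_, ?_⟩
      · ext i
        fin_cases i <;> simp [orient, h]
      · intro h3; exact h1 (by linarith)
      · intro h3; exact h2 (by linarith)
  obtain ⟨w, hw, k, hk, he⟩ := runToB_quadrant hr hx' hz' hy' h1' h2'
  refine ⟨w, ?_, k • ((letter r ![x, y, z]).matrix r *ᵥ ![x, y, z]), ?_, ?_⟩
  · rw [code, ho]; exact hw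
  · rw [bToB, ho]; exact he
  · rw [bMap, code, ho]; exact toSphere_smul hk _

/-! ### Periodic orbits, dominating eigenvectors, stability -/

/-- `u` is a point of `X` that generates a periodic orbit with the given pattern: the successive
iterates of the `b`-to-`b` mapping carry the letters of the pattern, and the orbit closes up
after one period. -/
def GeneratesPattern (r : ℝ) {n : ℕ} (s : Fin n → Block) (u : Vec) : Prop :=
  u ∈ domX ∧ (∀ k : Fin n, code r ((bMap r)^[k] u) = s k) ∧ (bMap r)^[n] u = u

/-- Along the orbit of `u`, the collisions of the particles follow the given pattern. -/
def CollisionsFollow (r : ℝ) {n : ℕ} (s : Fin n → Block) (u : Vec) : Prop :=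
  ∀ k : Fin n, ∃ w ∈ (s k).words, ∃ u' : Vec,
    bToB r ((bMap r)^[k] u) = some (w, u') ∧ toSphere u' = bMap r ((bMap r)^[k] u)

/-- The pattern `132312`. -/
def pattern132312 : Fin 6 → Block := ![.one, .three, .two, .three, .one, .two]

/-- The reduced collision matrix `J P₂ P₃ P₁` of the pattern. -/
def reducedMatrix (r : ℝ) : Matrix (Fin 3) (Fin 3) ℝ := J * P2 r * P3 r * P1 r

/-- `l` is the dominating eigenvalue of `M`: a simple eigenvalue, of modulus strictly larger than
that of all the other (real or complex) eigenvalues. -/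
def IsDominatingEigenvalue (M : Matrix (Fin 3) (Fin 3) ℝ) (l : ℝ) : Prop :=
  M.charpoly.rootMultiplicity l = 1 ∧
    ∀ m : ℂ, Polynomial.aeval m M.charpoly = 0 → m ≠ (l : ℂ) → ‖m‖ < |l|

/-- `u` is an eigenvector for the dominating eigenvalue of `M`, normalized by `u_x = 1`. -/
def IsDominatingEigenvector (M : Matrix (Fin 3) (Fin 3) ℝ) (u : Vec) : Prop :=
  (∃ l : ℝ, IsDominatingEigenvalue M l ∧ M *ᵥ u = l • u) ∧ u 0 = 1

/-- The orbit of `u` under `f : X → X` is locally (asymptotically) stable: orbits that start in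
`X` close enough to `u` remain arbitrarily close to the orbit of `u`, and converge to it. -/
def IsLocallyStableOrbit (f : Vec → Vec) (X : Set Vec) (u : Vec) : Prop :=
  (∀ ε > 0, ∃ δ > 0, ∀ v ∈ X, norm2 (v - u) < δ → ∀ n : ℕ, norm2 (f^[n] v - f^[n] u) < ε) ∧
    ∃ δ > 0, ∀ v ∈ X, norm2 (v - u) < δ →
      Tendsto (fun n : ℕ => norm2 (f^[n] v - f^[n] u)) atTop (𝓝 0)

end

end FourSpheres

open FourSpheres

namespace FourSpheres

/-! Write M for `reducedMatrix r`. The mirror symmetry u ↦ -Ju preserves the quadrant x ≥ 0, z ≤ 0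
and exchanges the letters 1 and 3, and 132312 is 132 followed by its mirror image. Hence the matrix
of a full period is M² (`prefixProd_six`), and an eigenvector of M for a negative eigenvalue -l
follows the whole pattern as soon as its first three iterates lie in the right open cones
(`mem_cell_of_eigenvector`).

The characteristic polynomial of M at -x is -q(r, x). A piecewise explicit L(r) with q(r, L) < 0
produces a zero l > L of q, large enough for the Schur–Cohn inequalities; so -l dominates for every
r in ]0,1[ (`exists_isRoot`, `isDominatingEigenvalue_of_charpoly`).

Elimination in the eigenvector equations relates A = αy - x (`excess`) to a second quantity B
(`depth`) by (l² - r⁸) A = α B · `margin r l`. Here `margin r l` = r⁵ - K l with K = (1 - 4r +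
r²)/2, and K³ q(r, r⁵/K) factors explicitly with `critPoly r` as a factor (`critPoly_identity`). So
for r > 11/50 the margin is positive wherever `critPoly r` < 0, and it vanishes with `critPoly r`.
Conversely A = 0 forces `critPoly r = 0` for any r in ]0,1[, and `critPoly` is strictly decreasing
there. Beyond its root, A and B are positive and all cone conditions follow (`IsRoot.mem_cell`).

Uniqueness: a periodic point v satisfies M²v = m²v with m > 0. Splitting v along the eigenvalues m
and -m, dominance of -l leaves only multiples of the eigenvector (`GeneratesPattern.eq_toSphere`).
Stability: the powers of -M/l converge to a projector onto the eigenline, so nearby orbits stay in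
the open cones, where the mapping is linear up to normalization, and converge to the periodic orbit.
-/

/-! ### Polynomial inequalities for the characteristic polynomial. -/

/-- The trace of the reduced collision matrix. -/
noncomputable def tr (r : ℝ) : ℝ :=
  (-1 + 8 * r - 21 * r ^ 2 + 29 * r ^ 4 + 24 * r ^ 5 - 7 * r ^ 6) / 32

/-- The sum of the principal minors of order two of the reduced collision matrix. -/
noncomputable def sm (r : ℝ) : ℝ :=
  (7 * r ^ 5 - 24 * r ^ 6 - 29 * r ^ 7 + 21 * r ^ 9 - 8 * r ^ 10 + r ^ 11) / 32

/-- The value at `-x` of the characteristic polynomial of the reduced collision matrix, up to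
sign. -/
noncomputable def q (r x : ℝ) : ℝ := x ^ 3 + tr r * x ^ 2 + sm r * x - r ^ 11

/-- Positivity certificate in Bernstein form, also used in the estimates below: with x and y the
rescaled distances of r to the ends of an interval, x + y is constant, so a polynomial in r can be
made homogeneous in x and y; there all its coefficients turn out positive. Powers of r or of 1 - r
are factored out where needed. -/
theorem q_const_neg_left {r : ℝ} (h0 : 0 < r) (h1 : r < 17 / 100) :
    0 < -q r (19 / 5000) := by
  obtain ⟨x, hx⟩ : ∃ x, x = 100 * r := ⟨_, rfl⟩
  obtain ⟨y, hy⟩ : ∃ y, y = 17 - 100 * r := ⟨_, rfl⟩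
  have hx0 : 0 < x := by linarith
  have hy0 : 0 < y := by linarith
  have h : -q r (19 / 5000) =
      (634204800000000000000 * y ^ 11 + 5994332800000000000000 * x * y ^ 10 +
        25500245800000000000000 * x ^ 2 * y ^ 9 +
        64401028200000000000000 * x ^ 3 * y ^ 8 +
        107214241173020000000000 * x ^ 4 * y ^ 7 +
        123292974101930400000000 * x ^ 5 * y ^ 6 +
        99364825684076126000000 * x ^ 6 * y ^ 5 +
        55387260408006930000000 * x ^ 7 * y ^ 4 +
        20374901774174460000000 * x ^ 8 * y ^ 3 +
        4469726854079836970000 * x ^ 9 * y ^ 2 + 470937240833070764800 * x ^ 10 * y +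
        19516960329681229773 * x ^ 11) / 54835034092212800000000000000000000000000 := by
    simp only [hx, hy, q, tr, sm]
    ring
  rw [h]
  positivity

theorem q_const_neg_right {r : ℝ} (h0 : 16 / 100 < r) (h1 : r < 21 / 100) :
    0 < -q r (19 / 5000) := by
  obtain ⟨x, hx⟩ : ∃ x, x = 100 * r - 16 := ⟨_, rfl⟩
  obtain ⟨y, hy⟩ : ∃ y, y = 21 - 100 * r := ⟨_, rfl⟩
  have hx0 : 0 < x := by linarith
  have hy0 : 0 < y := by linarith
  have h : -q r (19 / 5000) =
      (37129119842601271296 * y ^ 11 + 309228350856834318336 * x * y ^ 10 +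
        1098829769173129134080 * x ^ 2 * y ^ 9 +
        2131781827795966525440 * x ^ 3 * y ^ 8 +
        2368762386972858849280 * x ^ 4 * y ^ 7 +
        1414504651591090583552 * x ^ 5 * y ^ 6 +
        443500806314821078912 * x ^ 6 * y ^ 5 +
        449368959442733156480 * x ^ 7 * y ^ 4 +
        805098416163160381440 * x ^ 8 * y ^ 3 +
        675340618710613036880 * x ^ 9 * y ^ 2 + 269699161090184163056 * x ^ 10 * y +
        42795258971089523001 * x ^ 11) / 78125000000000000000000000000000000 := by
    simp only [hx, hy, q, tr, sm]
    ring
  rw [h]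
  positivity

theorem sm_lt_const {r : ℝ} (h0 : 0 < r) (h1 : r < 21 / 100) :
    0 < (19 / 5000) ^ 2 - sm r := by
  obtain ⟨x, hx⟩ : ∃ x, x = 100 * r := ⟨_, rfl⟩
  obtain ⟨y, hy⟩ : ∃ y, y = 21 - 100 * r := ⟨_, rfl⟩
  have hx0 : 0 < x := by linarith
  have hy0 : 0 < y := by linarith
  have h : (19 / 5000) ^ 2 - sm r =
      (4620800000000000000 * y ^ 11 + 50828800000000000000 * x * y ^ 10 +
        254144000000000000000 * x ^ 2 * y ^ 9 +
        762432000000000000000 * x ^ 3 * y ^ 8 +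
        1524864000000000000000 * x ^ 4 * y ^ 7 +
        2106220893000000000000 * x ^ 5 * y ^ 6 +
        1983861227040000000000 * x ^ 6 * y ^ 5 +
        1204175896968900000000 * x ^ 7 * y ^ 4 +
        417389177475600000000 * x ^ 8 * y ^ 3 + 62324227203617990000 * x ^ 9 * y ^ 2 +
        2788276560818540800 * x ^ 10 * y + 1685313626400008579 * x ^ 11)
        / 112088800173510720000000000000000000000 := by
    simp only [hx, hy, sm]
    ring
  rw [h]
  positivity

theorem tr_neg {r : ℝ} (h0 : 0 < r) (h1 : r < 7 / 15) :
    0 < -tr r := by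
  obtain ⟨x, hx⟩ : ∃ x, x = 15 * r := ⟨_, rfl⟩
  obtain ⟨y, hy⟩ : ∃ y, y = 7 - 15 * r := ⟨_, rfl⟩
  have hx0 : 0 < x := by linarith
  have hy0 : 0 < y := by linarith
  have h : -tr r =
      (11390625 * y ^ 6 + 25818750 * x * y ^ 5 + 10327500 * x ^ 2 * y ^ 4 +
        10935000 * x ^ 3 * y ^ 3 + 42501600 * x ^ 4 * y ^ 2 + 26707680 * x ^ 5 * y +
        65248 * x ^ 6) / 42883060500000 := by
    simp only [hx, hy, tr]
    ring
  rw [h]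
  positivity

theorem q_cubic_neg {r : ℝ} (h0 : 41 / 200 < r) (h1 : r < 82 / 200) :
    0 < -q r (11 / 20 * r ^ 3) := by
  obtain ⟨x, hx⟩ : ∃ x, x = 200 * r - 41 := ⟨_, rfl⟩
  obtain ⟨y, hy⟩ : ∃ y, y = 82 - 200 * r := ⟨_, rfl⟩
  have hx0 : 0 < x := by linarith
  have hy0 : 0 < y := by linarith
  have hr0 : 0 < r := by linarith
  have h : -q r (11 / 20 * r ^ 3) =
      r ^ 6 * (21440221358599269 * y ^ 8 + 659873063687254704 * x * y ^ 7 +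
        27837577033851061728 * x ^ 2 * y ^ 6 + 164423138949177418112 * x ^ 3 * y ^ 5 +
        428664983629990613280 * x ^ 4 * y ^ 4 +
        605595782804345314048 * x ^ 5 * y ^ 3 +
        484707878839461070848 * x ^ 6 * y ^ 2 + 207753246569926086656 * x ^ 7 * y +
        37200073828297208064 * x ^ 8) / 13082501495391846400000000000000000 := by
    simp only [hx, hy, q, tr, sm]
    ring
  rw [h]
  positivity

theorem sm_lt_cubic {r : ℝ} (h0 : 41 / 200 < r) (h1 : r < 82 / 200) :
    0 < (11 / 20 * r ^ 3) ^ 2 - sm r := by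
  obtain ⟨x, hx⟩ : ∃ x, x = 200 * r - 41 := ⟨_, rfl⟩
  obtain ⟨y, hy⟩ : ∃ y, y = 82 - 200 * r := ⟨_, rfl⟩
  have hx0 : 0 < x := by linarith
  have hy0 : 0 < y := by linarith
  have hr0 : 0 < r := by linarith
  have h : (11 / 20 * r ^ 3) ^ 2 - sm r =
      r ^ 5 * (69686980577359 * y ^ 6 + 1007404075486708 * x * y ^ 5 +
        4057254680985540 * x ^ 2 * y ^ 4 + 7540981720793440 * x ^ 3 * y ^ 3 +
        7306635081478160 * x ^ 4 * y ^ 2 + 3600602099844928 * x ^ 5 * y +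
        715406402979776 * x ^ 6) / 9728213485568000000000000 := by
    simp only [hx, hy, sm]
    ring
  rw [h]
  positivity

theorem cubic_add_tr_pos {r : ℝ} (h0 : 44 / 200 < r) (h1 : r < 82 / 200) :
    0 < 11 / 20 * r ^ 3 + tr r := by
  obtain ⟨x, hx⟩ : ∃ x, x = 200 * r - 44 := ⟨_, rfl⟩
  obtain ⟨y, hy⟩ : ∃ y, y = 82 - 200 * r := ⟨_, rfl⟩
  have hx0 : 0 < x := by linarith
  have hy0 : 0 < y := by linarith
  have h : 11 / 20 * r ^ 3 + tr r =
      (10514097472 * y ^ 6 + 597013074496 * x * y ^ 5 +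
        2875986068720 * x ^ 2 * y ^ 4 + 6109304854880 * x ^ 3 * y ^ 3 +
        6949992355980 * x ^ 4 * y ^ 2 + 4157688356676 * x ^ 5 * y +
        1027184442713 * x ^ 6) / 96349964288000000000000 := by
    simp only [hx, hy, tr]
    ring
  rw [h]
  positivity

/-- At r = 1, q is (x - 1)(x + 1)², with the simple zero 1. The value r³ - (1 - r)³/8 agrees with
the nearby zero of q(r, ·) up to order (1 - r)⁴, whence the factor (1 - r)⁴. -/
theorem q_near_one_neg {r : ℝ} (h0 : 4 / 10 < r) (h1 : r < 1) :
    0 < -q r (r ^ 3 - (1 - r) ^ 3 / 8) := by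
  obtain ⟨x, hx⟩ : ∃ x, x = 10 * r - 4 := ⟨_, rfl⟩
  obtain ⟨y, hy⟩ : ∃ y, y = 10 - 10 * r := ⟨_, rfl⟩
  have hx0 : 0 < x := by linarith
  have hy0 : 0 < y := by linarith
  have hr0 : 0 < r := by linarith
  have hr1 : 0 < 1 - r := by linarith
  have h : -q r (r ^ 3 - (1 - r) ^ 3 / 8) =
      (1 - r) ^ 4 * (4122739 * y ^ 10 + 110281640 * x * y ^ 9 + 1194477975 * x ^ 2 * y ^ 8 +
        6971598750 * x ^ 3 * y ^ 7 + 25056825000 * x ^ 4 * y ^ 6 +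
        59187712500 * x ^ 5 * y ^ 5 + 94280250000 * x ^ 6 * y ^ 4 +
        100792500000 * x ^ 7 * y ^ 3 + 69525000000 * x ^ 8 * y ^ 2 +
        28000000000 * x ^ 9 * y + 5000000000 * x ^ 10) / 403107840000000000 := by
    simp only [hx, hy, q, tr, sm]
    ring
  rw [h]
  positivity

theorem pow_lt_near_one {r : ℝ} (h0 : 4 / 10 < r) (h1 : r < 1) :
    0 < (r ^ 3 - (1 - r) ^ 3 / 8) ^ 3 - r ^ 11 := by
  obtain ⟨x, hx⟩ : ∃ x, x = 10 * r - 4 := ⟨_, rfl⟩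
  obtain ⟨y, hy⟩ : ∃ y, y = 10 - 10 * r := ⟨_, rfl⟩
  have hx0 : 0 < x := by linarith
  have hy0 : 0 < y := by linarith
  have hr0 : 0 < r := by linarith
  have hr1 : 0 < 1 - r := by linarith
  have h : (r ^ 3 - (1 - r) ^ 3 / 8) ^ 3 - r ^ 11 =
      (1 - r) * (72583 * y ^ 10 + 7660270 * x * y ^ 9 + 167318775 * x ^ 2 * y ^ 8 +
        1645113000 * x ^ 3 * y ^ 7 + 8923440000 * x ^ 4 * y ^ 6 +
        29775825000 * x ^ 5 * y ^ 5 + 64353000000 * x ^ 6 * y ^ 4 +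
        91110000000 * x ^ 7 * y ^ 3 + 82125000000 * x ^ 8 * y ^ 2 +
        43000000000 * x ^ 9 * y + 10000000000 * x ^ 10) / 302330880000000000 := by
    simp only [hx, hy]
    ring
  rw [h]
  positivity

theorem sq_near_one_add_sm_pos {r : ℝ} (h0 : 93 / 200 < r) (h1 : r < 1) :
    0 < (r ^ 3 - (1 - r) ^ 3 / 8) ^ 2 + sm r := by
  obtain ⟨x, hx⟩ : ∃ x, x = 200 * r - 93 := ⟨_, rfl⟩
  obtain ⟨y, hy⟩ : ∃ y, y = 200 - 200 * r := ⟨_, rfl⟩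
  have hx0 : 0 < x := by linarith
  have hy0 : 0 < y := by linarith
  have hr0 : 0 < r := by linarith
  have hr1 : 0 < 1 - r := by linarith
  have h : (r ^ 3 - (1 - r) ^ 3 / 8) ^ 2 + sm r =
      (1 - r) ^ 2 * (5490493595074246093 * y ^ 9 + 758318560674445280600 * x * y ^ 8 +
        9483831247078998880000 * x ^ 2 * y ^ 7 +
        51246044309325648000000 * x ^ 3 * y ^ 6 +
        154594146849153600000000 * x ^ 4 * y ^ 5 +
        285547429555040000000000 * x ^ 5 * y ^ 4 +
        331481717376000000000000 * x ^ 6 * y ^ 3 +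
        236494592000000000000000 * x ^ 7 * y ^ 2 +
        94863360000000000000000 * x ^ 8 * y + 16384000000000000000000 * x ^ 9)
        / 30121315736291811442688000000000000000000 := by
    simp only [hx, hy, sm]
    ring
  rw [h]
  positivity

theorem sm_neg {r : ℝ} (h0 : 4 / 10 < r) (h1 : r < 1) :
    0 < -sm r := by
  obtain ⟨x, hx⟩ : ∃ x, x = 10 * r - 4 := ⟨_, rfl⟩
  obtain ⟨y, hy⟩ : ∃ y, y = 10 - 10 * r := ⟨_, rfl⟩
  have hx0 : 0 < x := by linarith
  have hy0 : 0 < y := by linarith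
  have hr0 : 0 < r := by linarith
  have h : -sm r =
      r ^ 5 * (105941 * y ^ 6 + 1036770 * x * y ^ 5 + 3671100 * x ^ 2 * y ^ 4 +
        6361000 * x ^ 3 * y ^ 3 + 5820000 * x ^ 4 * y ^ 2 + 2700000 * x ^ 5 * y +
        500000 * x ^ 6) / 23328000000 := by
    simp only [hx, hy, sm]
    ring
  rw [h]
  positivity

theorem near_one_add_tr_pos {r : ℝ} (h0 : 4 / 10 < r) (h1 : r < 1) :
    0 < (r ^ 3 - (1 - r) ^ 3 / 8) + tr r := by
  obtain ⟨x, hx⟩ : ∃ x, x = 10 * r - 4 := ⟨_, rfl⟩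
  obtain ⟨y, hy⟩ : ∃ y, y = 10 - 10 * r := ⟨_, rfl⟩
  have hx0 : 0 < x := by linarith
  have hy0 : 0 < y := by linarith
  have h : (r ^ 3 - (1 - r) ^ 3 / 8) + tr r =
      (15367 * y ^ 6 + 288570 * x * y ^ 5 + 1497600 * x ^ 2 * y ^ 4 +
        3789500 * x ^ 3 * y ^ 3 + 5160000 * x ^ 4 * y ^ 2 + 3600000 * x ^ 5 * y +
        1000000 * x ^ 6) / 23328000000 := by
    simp only [hx, hy, tr]
    ring
  rw [h]
  positivity

/-! ### Existence of the dominating root. -/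

/-- The properties of a number `l > 0` that make `-l` the dominating eigenvalue of the reduced
collision matrix. -/
structure IsRoot (r l : ℝ) : Prop where
  pos : 0 < l
  root : q r l = 0
  pow_lt : r ^ 11 < l ^ 3
  sq_add : 0 < l ^ 2 + sm r
  cube_sub : 0 < l ^ 3 - sm r * l + 2 * r ^ 11
  tr_add_pos : 11 / 50 < r → 0 < l + tr r
  pow_four_lt : 11 / 50 < r → r ^ 4 < l

theorem exists_q_eq_zero {r L : ℝ} (h0 : 0 < r) (h1 : r < 1) (hL : L < 3) (hq : q r L < 0) :
    ∃ l, L < l ∧ q r l = 0 := by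
  have h3 : 0 < q r 3 := by
    have e2 : r ^ 2 ≤ 1 := pow_le_one₀ h0.le h1.le
    have e6 : r ^ 6 ≤ 1 := pow_le_one₀ h0.le h1.le
    have e7 : r ^ 7 ≤ 1 := pow_le_one₀ h0.le h1.le
    have e10 : r ^ 10 ≤ 1 := pow_le_one₀ h0.le h1.le
    have e11 : r ^ 11 ≤ 1 := pow_le_one₀ h0.le h1.le
    have p4 : 0 < r ^ 4 := by positivity
    have p5 : 0 < r ^ 5 := by positivity
    have p9 : 0 < r ^ 9 := by positivity
    have p11 : 0 < r ^ 11 := by positivity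
    simp only [q, tr, sm]
    linarith
  have hc : ContinuousOn (q r) (Icc L 3) := by
    unfold q
    fun_prop
  obtain ⟨l, hl, e⟩ := intermediate_value_Ioo hL.le hc ⟨hq, h3⟩
  exact ⟨l, hl.1, e⟩

/-- All the required inequalities except one only ask that l be large, so they pass from a lower
bound L with q(r, L) < 0 to the zero above it. The exception, l² + `sm r` > 0, can also be read off
q(r, l) = 0 when `tr r` ≤ 0. -/
theorem exists_isRoot {r : ℝ} (h0 : 0 < r) (h1 : r < 1) : ∃ l, IsRoot r l := by
  have key : ∀ L : ℝ, 0 < L → L < 3 → q r L < 0 → r ^ 11 ≤ L ^ 3 →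
      (tr r ≤ 0 ∨ 0 < L ^ 2 + sm r) → (sm r ≤ 0 ∨ sm r ≤ L ^ 2) →
      (11 / 50 < r → 0 < L + tr r) → (11 / 50 < r → r ^ 4 ≤ L) → ∃ l, IsRoot r l := by
    intro L hL hL3 hq h11 ht hs hS h4
    obtain ⟨l, hl, e⟩ := exists_q_eq_zero h0 h1 hL3 hq
    have hl0 : 0 < l := hL.trans hl
    have hr : 0 < r ^ 11 := by positivity
    have hLl : L ^ 2 < l ^ 2 := by gcongr
    refine ⟨l, hl0, e, h11.trans_lt (by gcongr), ?_, ?_, fun h => ?_, fun h => ?_⟩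
    · rcases ht with ht | ht
      · have e' : l * (l ^ 2 + sm r) = r ^ 11 - tr r * l ^ 2 := by
          unfold q at e
          linarith
        have : tr r * l ^ 2 ≤ 0 := mul_nonpos_of_nonpos_of_nonneg ht (sq_nonneg l)
        exact pos_of_mul_pos_right (by linarith) hl0.le
      · linarith
    · have : 0 < l * (l ^ 2 - sm r) := by
        apply mul_pos hl0
        rcases hs with hs | hs
        · linarith [pow_pos hl0 2]
        · linarith
      linarith
    · linarith [hS h]
    · linarith [h4 h]
  -- Three choices of L: a constant, 11/20 · r³, and the expansion at r = 1. On the first range the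
  -- clauses assuming r > 11/50 are vacuous.
  rcases lt_or_ge r (21 / 100) with h | h
  · refine key (19 / 5000) (by norm_num) (by norm_num) ?_ ?_ (Or.inl ?_) (Or.inr ?_) ?_ ?_
    · rcases lt_or_ge r (17 / 100) with h' | h'
      · linarith [q_const_neg_left h0 h']
      · linarith [q_const_neg_right (by linarith) h]
    · calc r ^ 11 ≤ (21 / 100) ^ 11 := by gcongr
        _ ≤ _ := by norm_num
    · linarith [tr_neg h0 (by linarith)]
    · linarith [sm_lt_const h0 h]
    · intro; linarith
    · intro; linarith
  rcases lt_or_ge r (81 / 200) with h' | h'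
  · have h3 : 0 < r ^ 3 := by positivity
    have h31 : r ^ 3 < 1 := pow_lt_one₀ h0.le h1 (by norm_num)
    refine key (11 / 20 * r ^ 3) (by positivity) (by linarith) ?_ ?_ (Or.inl ?_) (Or.inr ?_) ?_ ?_
    · linarith [q_cubic_neg (r := r) (by linarith) (by linarith)]
    · have : r ^ 2 ≤ (11 / 20) ^ 3 := by nlinarith
      calc r ^ 11 = r ^ 2 * r ^ 9 := by ring
        _ ≤ (11 / 20) ^ 3 * r ^ 9 := by gcongr
        _ = _ := by ring
    · linarith [tr_neg h0 (by linarith)]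
    · linarith [sm_lt_cubic (r := r) (by linarith) (by linarith)]
    · intro h2
      linarith [cubic_add_tr_pos (r := r) (by linarith) (by linarith)]
    · intro
      calc r ^ 4 = r * r ^ 3 := by ring
        _ ≤ 11 / 20 * r ^ 3 := by gcongr; linarith
  · have h3 : (2 / 5) ^ 3 ≤ r ^ 3 := by gcongr; linarith
    have h31 : r ^ 3 < 1 := pow_lt_one₀ h0.le h1 (by norm_num)
    have e0 : 0 < 1 - r := by linarith
    have e2 : (1 - r) ^ 2 ≤ (3 / 5) ^ 2 := by gcongr; linarith
    have e4 : r ^ 4 ≤ r ^ 3 - (1 - r) ^ 3 / 8 := by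
      have : 0 ≤ (1 - r) * (r ^ 3 - (1 - r) ^ 2 / 8) := mul_nonneg e0.le (by linarith)
      linarith
    refine key (r ^ 3 - (1 - r) ^ 3 / 8) ((pow_pos h0 4).trans_le e4) ?_ ?_ ?_ ?_ (Or.inl ?_)
      ?_ fun _ => e4
    · linarith [pow_pos e0 3]
    · linarith [q_near_one_neg (r := r) (by linarith) h1]
    · linarith [pow_lt_near_one (r := r) (by linarith) h1]
    -- `tr r` is negative below 7/15 but equals 1 at r = 1, so the upper range needs the direct
    -- bound L² + `sm r` > 0.
    · rcases lt_or_ge r (7 / 15) with h2 | h2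
      · exact Or.inl (by linarith [tr_neg h0 h2])
      · exact Or.inr (sq_near_one_add_sm_pos (by linarith) h1)
    · linarith [sm_neg (r := r) (by linarith) h1]
    · intro
      linarith [near_one_add_tr_pos (r := r) (by linarith) h1]

/-! ### Dominating eigenvalues of three by three matrices. -/

theorem charpoly_fin_three {R : Type*} [CommRing R] (M : Matrix (Fin 3) (Fin 3) R) :
    M.charpoly = Polynomial.X ^ 3 - Polynomial.C (M 0 0 + M 1 1 + M 2 2) * Polynomial.X ^ 2 +
      Polynomial.C (M 0 0 * M 1 1 - M 0 1 * M 1 0 + (M 0 0 * M 2 2 - M 0 2 * M 2 0) +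
        (M 1 1 * M 2 2 - M 1 2 * M 2 1)) * Polynomial.X - Polynomial.C M.det := by
  rw [Matrix.charpoly, Matrix.det_fin_three, Matrix.det_fin_three]
  simp
  ring

/-- Criterion for `-l` to be the dominating eigenvalue (after Schur and Cohn). -/
theorem isDominatingEigenvalue_of_charpoly {M : Matrix (Fin 3) (Fin 3) ℝ} {t s d l : ℝ}
    (hM : M.charpoly = Polynomial.X ^ 3 - Polynomial.C t * Polynomial.X ^ 2 +
      Polynomial.C s * Polynomial.X + Polynomial.C d)
    (hd : 0 < d) (hl : 0 < l) (hroot : l ^ 3 + t * l ^ 2 + s * l - d = 0) (hdl : d < l ^ 3)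
    (hs : 0 < l ^ 2 + s) (h3 : 0 < l ^ 3 - s * l + 2 * d) :
    IsDominatingEigenvalue M (-l) := by
  -- The other two eigenvalues have product p and sum t + l.
  obtain ⟨p, hp⟩ : ∃ p, p = d / l := ⟨_, rfl⟩
  have hpl : p * l = d := by rw [hp]; field_simp
  have hp0 : 0 < p := by rw [hp]; positivity
  have hfac : M.charpoly = (Polynomial.X - Polynomial.C (-l)) *
      (Polynomial.X ^ 2 - Polynomial.C (t + l) * Polynomial.X + Polynomial.C p) := by
    have hs' : s = p - l * (t + l) := by
      have : l * (s - (p - l * (t + l))) = 0 := by linear_combination hroot - hpl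
      rcases mul_eq_zero.1 this with h | h
      · exact absurd h hl.ne'
      · linarith
    rw [hM, hs', ← hpl]
    simp
    ring
  -- Schur–Cohn conditions for X² - (t + l)X + p to have both roots in the open disk of radius l: |t
  -- + l| l < l² + p and p < l². Multiplied by l, they are the hypotheses `hs`, `h3` and `hdl`.
  have hS1 : (t + l) * l < l ^ 2 + p := by
    have : l * ((t + l) * l) < l * (l ^ 2 + p) := by nlinarith
    exact lt_of_mul_lt_mul_left this hl.le
  have hS2 : -((t + l) * l) < l ^ 2 + p := by
    have : l * -((t + l) * l) < l * (l ^ 2 + p) := by nlinarith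
    exact lt_of_mul_lt_mul_left this hl.le
  have hpl2 : p < l ^ 2 := by
    have : l * p < l * l ^ 2 := by nlinarith
    exact lt_of_mul_lt_mul_left this hl.le
  constructor
  · have hne : (Polynomial.X ^ 2 - Polynomial.C (t + l) * Polynomial.X +
        Polynomial.C p).eval (-l) ≠ 0 := by
      simp
      nlinarith
    have h0 : M.charpoly ≠ 0 := M.charpoly_monic.ne_zero
    rw [hfac] at h0 ⊢
    rw [Polynomial.rootMultiplicity_mul h0, Polynomial.rootMultiplicity_X_sub_C_self,
      Polynomial.rootMultiplicity_eq_zero hne]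
  · intro m hm hne
    rw [hfac, map_mul, mul_eq_zero] at hm
    have h2 : m ^ 2 - (t + l) * m + p = 0 := by
      rcases hm with hm | hm
      · refine absurd ?_ hne
        simp at hm ⊢
        linear_combination hm
      · simpa using hm
    rw [abs_neg, abs_of_pos hl]
    have hre := congrArg Complex.re h2
    have him := congrArg Complex.im h2
    simp [pow_two] at hre him
    have hsq : m.re ^ 2 + m.im ^ 2 < l ^ 2 := by
      have him' : m.im * (2 * m.re - (t + l)) = 0 := by linear_combination him
      rcases mul_eq_zero.1 him' with h | h
      · rw [h] at hre ⊢
        have hx : m.re ^ 2 - (t + l) * m.re + p = 0 := by linear_combination hre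
        by_contra hge
        have hge : l ^ 2 ≤ m.re ^ 2 := by linarith
        -- The left side minus the right side is (m² - l²)(m²l² - p²), which is nonnegative when m²
        -- ≥ l² > p.
        have hfin : (m.re ^ 2 + p) ^ 2 * l ^ 2 < (l ^ 2 + p) ^ 2 * m.re ^ 2 := by
          have e : m.re ^ 2 + p = (t + l) * m.re := by linear_combination hx
          have hab : ((t + l) * l) ^ 2 < (l ^ 2 + p) ^ 2 := by
            apply sq_lt_sq.2
            rw [abs_of_pos (by positivity : 0 < l ^ 2 + p)]
            exact abs_lt.2 ⟨by linarith, hS1⟩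
          have hm0 : 0 < m.re ^ 2 := lt_of_lt_of_le (by positivity) hge
          calc (m.re ^ 2 + p) ^ 2 * l ^ 2 = ((t + l) * l) ^ 2 * m.re ^ 2 := by rw [e]; ring
            _ < _ := by gcongr
        have : 0 ≤ (m.re ^ 2 - l ^ 2) * (m.re ^ 2 * l ^ 2 - p ^ 2) := by
          apply mul_nonneg (by linarith)
          nlinarith
        linarith
      -- Here m has real part (t + l)/2, so the other root is its conjugate and |m|² is the product
      -- p.
      · have e : m.re ^ 2 + m.im ^ 2 = p := by
          have : t + l = 2 * m.re := by linarith
          rw [this] at hre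
          linear_combination -hre
        linarith
    rw [Complex.norm_eq_sqrt_sq_add_sq]
    exact (Real.sqrt_lt' hl).2 hsq

theorem reducedMatrix_charpoly (r : ℝ) : (reducedMatrix r).charpoly =
    Polynomial.X ^ 3 - Polynomial.C (tr r) * Polynomial.X ^ 2 +
      Polynomial.C (sm r) * Polynomial.X + Polynomial.C (r ^ 11) := by
  have hdet : (reducedMatrix r).det = -r ^ 11 := by
    have hJ : J.det = -1 := by simp [J, Matrix.det_fin_three]
    have h1 : (P1 r).det = r ^ 4 := by
      simp [P1, Matrix.det_fin_three]
      ring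
    have h2 : (P2 r).det = r ^ 3 := by
      simp [P2, Matrix.det_fin_three]
      ring
    have h3 : (P3 r).det = r ^ 4 := by
      simp [P3, Matrix.det_fin_three]
      ring
    rw [reducedMatrix, Matrix.det_mul, Matrix.det_mul, Matrix.det_mul, hJ, h1, h2, h3]
    ring
  rw [charpoly_fin_three, hdet]
  have ht : reducedMatrix r 0 0 + reducedMatrix r 1 1 + reducedMatrix r 2 2 = tr r := by
    simp [reducedMatrix, J, P1, P2, P3, Matrix.mul_apply, Fin.sum_univ_three, alpha, tr]
    ring
  have hs : reducedMatrix r 0 0 * reducedMatrix r 1 1 - reducedMatrix r 0 1 * reducedMatrix r 1 0 +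
      (reducedMatrix r 0 0 * reducedMatrix r 2 2 - reducedMatrix r 0 2 * reducedMatrix r 2 0) +
      (reducedMatrix r 1 1 * reducedMatrix r 2 2 - reducedMatrix r 1 2 * reducedMatrix r 2 1) =
      sm r := by
    simp [reducedMatrix, J, P1, P2, P3, Matrix.mul_apply, Fin.sum_univ_three, alpha, sm]
    ring
  rw [ht, hs, map_neg]
  ring

theorem IsRoot.isDominatingEigenvalue {r l : ℝ} (h : IsRoot r l) (hr : 0 < r) :
    IsDominatingEigenvalue (reducedMatrix r) (-l) :=
  isDominatingEigenvalue_of_charpoly (reducedMatrix_charpoly r) (by positivity) h.pos h.root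
    h.pow_lt h.sq_add h.cube_sub

theorem IsDominatingEigenvalue.isRoot {M : Matrix (Fin 3) (Fin 3) ℝ} {l : ℝ}
    (h : IsDominatingEigenvalue M l) : M.charpoly.IsRoot l :=
  (Polynomial.rootMultiplicity_pos M.charpoly_monic.ne_zero).1 (by rw [h.1]; exact one_pos)

theorem IsDominatingEigenvalue.abs_lt {M : Matrix (Fin 3) (Fin 3) ℝ} {l m : ℝ}
    (h : IsDominatingEigenvalue M l) (hm : M.charpoly.IsRoot m) (hne : m ≠ l) : |m| < |l| := by
  have := h.2 m (by
    rw [Polynomial.aeval_def, ← Complex.coe_algebraMap, Polynomial.eval₂_at_apply, hm.eq_zero,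
      map_zero]) (by exact_mod_cast hne)
  simpa using this

theorem IsDominatingEigenvalue.unique {M : Matrix (Fin 3) (Fin 3) ℝ} {l m : ℝ}
    (hl : IsDominatingEigenvalue M l) (hm : IsDominatingEigenvalue M m) : m = l := by
  by_contra hne
  exact lt_asymm (hl.abs_lt hm.isRoot hne) (hm.abs_lt hl.isRoot (Ne.symm hne))

theorem isRoot_charpoly_iff {M : Matrix (Fin 3) (Fin 3) ℝ} {m : ℝ} :
    M.charpoly.IsRoot m ↔ ∃ v : Vec, v ≠ 0 ∧ M *ᵥ v = m • v := by
  rw [Polynomial.IsRoot, Matrix.eval_charpoly, ← Matrix.exists_mulVec_eq_zero_iff]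
  refine exists_congr fun v => and_congr_right fun _ => ?_
  rw [Matrix.sub_mulVec, sub_eq_zero, Matrix.scalar_apply, ← Matrix.smul_one_eq_diagonal,
    Matrix.smul_mulVec, Matrix.one_mulVec, eq_comm]

/-! ### Linear relations satisfied by an eigenvector. -/

theorem vec3_eta (u : Vec) : ![u 0, u 1, u 2] = u := by
  ext i
  fin_cases i <;> rfl

theorem reducedMatrix_mulVec (r : ℝ) (u : Vec) :
    reducedMatrix r *ᵥ u = J *ᵥ (P2 r *ᵥ (P3 r *ᵥ (P1 r *ᵥ u))) := by
  simp [reducedMatrix, Matrix.mulVec_mulVec, Matrix.mul_assoc]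

theorem J_mulVec (u : Vec) : J *ᵥ u = ![u 2, u 1, u 0] := by
  rw [← vec3_eta u]
  ext i
  fin_cases i <;> simp [J, Matrix.mulVec, Matrix.vecHead, Matrix.vecTail]

/-- The excess `αy - x`, which is positive when the first collision pattern is `ab`. -/
noncomputable def excess (r : ℝ) (u : Vec) : ℝ := alpha r * u 1 - u 0

/-- The opposite of the middle coordinate of `P₃ P₁ u`. -/
noncomputable def depth (r : ℝ) (u : Vec) : ℝ := -(P3 r *ᵥ (P1 r *ᵥ u)) 1

/-- For an eigenvector, `excess` and `depth` have the ratio `margin` up to a positive factor. -/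
noncomputable def margin (r l : ℝ) : ℝ := (-1 + 4 * r - r ^ 2) / 2 * l + r ^ 5

theorem P1_mulVec' (r : ℝ) (u : Vec) : P1 r *ᵥ u =
    ![r * (alpha r * u 1 - u 0),
      alpha r * (alpha r * u 1 - u 0) - r * u 1 + r * alpha r * u 2, r ^ 2 * u 2] := by
  rw [← P1_mulVec, vec3_eta]

theorem P2_mulVec' (r : ℝ) (u : Vec) : P2 r *ᵥ u =
    ![-(r * (alpha r * u 1 - u 0)),
      -(alpha r * (alpha r * u 1 - u 0)) - alpha r * (alpha r * u 1 - u 2) + r * u 1,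
      -(r * (alpha r * u 1 - u 2))] := by
  rw [← P2_mulVec, vec3_eta]

theorem P3_mulVec' (r : ℝ) (u : Vec) : P3 r *ᵥ u =
    ![r ^ 2 * u 0, alpha r * (alpha r * u 1 - u 2) - r * u 1 + r * alpha r * u 0,
      r * (alpha r * u 1 - u 2)] := by
  rw [← P3_mulVec, vec3_eta]

/-- The relations between the coordinates of an eigenvector of the reduced collision matrix. -/
structure EigenRelations (r l : ℝ) (u : Vec) : Prop where
  first : r * ((alpha r ^ 2 * r ^ 3 + l) * excess r u +
    alpha r * (alpha r ^ 2 - r) * depth r u) = l * (alpha r ^ 2 - r) * u 0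
  ratio : (l ^ 2 - r ^ 8) * excess r u = alpha r * depth r u * margin r l
  third : l * u 2 = -(r * (r ^ 3 * excess r u + alpha r * depth r u))
  coord : r * (P3 r *ᵥ (P1 r *ᵥ u)) 2 = -(r * alpha r * depth r u) - l * u 0

/-- With w = P₃P₁u, the eigenvector equation reads JP₂w = -lu, and its three rows are combined with
w₀ = r³ · `excess` and w₁ = -`depth`. The relation `ratio` comes from eliminating both u₀ and w₂. -/
theorem eigenRelations {r l : ℝ} {u : Vec} (hr : r ≠ 0)
    (h : reducedMatrix r *ᵥ u = (-l) • u) : EigenRelations r l u := by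
  have hw0 : (P3 r *ᵥ (P1 r *ᵥ u)) 0 = r ^ 3 * excess r u := by
    rw [P3_mulVec', P1_mulVec', excess]
    simp
    ring
  -- This identity, valid for every u, is obtained by eliminating the middle coordinate of P₁u
  -- between w₁ and w₂.
  have hid : r * alpha r * (P3 r *ᵥ (P1 r *ᵥ u)) 1 = (alpha r ^ 2 - r) * (P3 r *ᵥ (P1 r *ᵥ u)) 2
      - r ^ 4 * u 2 + r ^ 3 * alpha r ^ 2 * excess r u := by
    rw [P3_mulVec', P1_mulVec', excess]
    simp
    ring
  rw [reducedMatrix_mulVec, J_mulVec, P2_mulVec'] at h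
  have h0 := congrFun h 0
  have h1 := congrFun h 1
  have h2 := congrFun h 2
  have hy : alpha r * u 1 = excess r u + u 0 := by
    rw [excess]
    ring
  simp only [Matrix.cons_val, Pi.smul_apply, smul_eq_mul, Fin.isValue] at h0 h1 h2
  have hB : (P3 r *ᵥ (P1 r *ᵥ u)) 1 = -depth r u := by
    rw [depth]
    ring
  rw [hB] at h0 h1 h2 hid
  rw [hw0] at h1 h2
  obtain ⟨c, hc⟩ : ∃ c, c = (P3 r *ᵥ (P1 r *ᵥ u)) 2 := ⟨_, rfl⟩
  rw [← hc] at h0 h1 hid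
  have e1 : r * ((alpha r ^ 2 * r ^ 3 + l) * excess r u +
    alpha r * (alpha r ^ 2 - r) * depth r u) = l * (alpha r ^ 2 - r) * u 0 := by
    linear_combination alpha r * r * h1 - alpha r ^ 2 * h0 - r * l * hy
  have e3 : l * u 2 = -(r * (r ^ 3 * excess r u + alpha r * depth r u)) := by
    linear_combination h2
  refine ⟨e1, ?_, e3, by rw [← hc]; linear_combination h0⟩
  have hα : (-1 + 4 * r - r ^ 2) / 2 = 3 * r - 2 * alpha r ^ 2 := by
    unfold alpha
    ring
  have : r * ((l ^ 2 - r ^ 8) * excess r u) = r * (alpha r * depth r u * margin r l) := by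
    rw [margin, hα]
    linear_combination l * e1 + r * l * hid + (alpha r ^ 2 - r) * l * h0 - r ^ 5 * e3
  exact mul_left_cancel₀ hr this

/-! ### The critical coefficient and the sign of the margin. -/

/-- The polynomial whose root in `]0,1[` is the critical restitution coefficient. -/
def critPoly (r : ℝ) : ℝ := 5 - 22 * r - 2 * r ^ 2 - 6 * r ^ 3 + r ^ 4

/-- The only increasing term, r⁴, has slope at most 4 on ]0,1[, which the slope -22 of the linear
term outweighs. -/
theorem critPoly_lt {a b : ℝ} (ha : 0 < a) (hab : a < b) (hb : b < 1) :
    critPoly b < critPoly a := by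
  have h2 : a ^ 2 < b ^ 2 := by gcongr
  have h3 : a ^ 3 < b ^ 3 := by gcongr
  have h4 : b ^ 4 - a ^ 4 ≤ 4 * (b - a) := by
    have e : b ^ 4 - a ^ 4 = (b + a) * (b ^ 2 + a ^ 2) * (b - a) := by ring
    have hb2 : b ^ 2 ≤ 1 := pow_le_one₀ (by linarith) hb.le
    have h : (b + a) * (b ^ 2 + a ^ 2) ≤ 2 * 2 :=
      mul_le_mul (by linarith) (by linarith) (by positivity) (by norm_num)
    rw [e]
    nlinarith
  unfold critPoly
  linarith

theorem exists_critPoly_eq_zero : ∃ rc ∈ Ioo (0.22006978614631047520 : ℝ) 0.22006978614631047521,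
    critPoly rc = 0 := by
  have hc : ContinuousOn critPoly (Icc 0.22006978614631047520 0.22006978614631047521) := by
    unfold critPoly
    fun_prop
  refine intermediate_value_Ioo' (by norm_num) hc ⟨?_, ?_⟩ <;> norm_num [critPoly]

theorem IsRoot.q_eq {r l : ℝ} (h : IsRoot r l) (x : ℝ) :
    q r x = (x - l) * (x ^ 2 + (l + tr r) * x + r ^ 11 / l) := by
  have hl := h.pos.ne'
  have e := h.root
  have hs : sm r = r ^ 11 / l - l ^ 2 - tr r * l := by
    unfold q at e
    field_simp
    linear_combination e
  unfold q
  rw [hs]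
  field_simp
  ring

/-- The cofactor of x - l in q has positive coefficients. Thus l is the only positive zero of q, and
the sign of q at x > 0 tells on which side of l the point x lies. -/
theorem IsRoot.factor_pos {r l x : ℝ} (h : IsRoot r l) (hr : 11 / 50 < r) (hx : 0 < x) :
    0 < x ^ 2 + (l + tr r) * x + r ^ 11 / l := by
  have h1 := h.tr_add_pos hr
  have h2 := h.pos
  have : 0 < r := by linarith
  positivity

theorem IsRoot.eq_of_q_eq_zero {r l x : ℝ} (h : IsRoot r l) (hr : 11 / 50 < r) (hx : 0 < x)
    (hq : q r x = 0) : x = l := by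
  rw [h.q_eq, mul_eq_zero] at hq
  rcases hq with hq | hq
  · linarith
  · exact absurd hq (h.factor_pos hr hx).ne'

theorem isRoot_charpoly_neg {r x : ℝ} : (reducedMatrix r).charpoly.IsRoot (-x) ↔ q r x = 0 := by
  rw [reducedMatrix_charpoly, Polynomial.IsRoot, q]
  simp
  constructor <;> intro h <;> linear_combination -h

/-- For K = (1 - 4r + r²)/2 ≠ 0, the left side is K³ q(r, r⁵/K), and r⁵/K is the value of l at which
the margin vanishes. The factor 1 - 6r + r² is negative for r in ]3 - 2√2, 1[. -/
theorem critPoly_identity (r : ℝ) : (r ^ 5) ^ 3 + tr r * ((1 - 4 * r + r ^ 2) / 2) * (r ^ 5) ^ 2 +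
    sm r * ((1 - 4 * r + r ^ 2) / 2) ^ 2 * r ^ 5 - ((1 - 4 * r + r ^ 2) / 2) ^ 3 * r ^ 11 =
    r ^ 10 * (1 - r) ^ 4 * (1 - 6 * r + r ^ 2) / 128 * critPoly r := by
  unfold tr sm critPoly
  ring

theorem IsRoot.margin_identity {r l : ℝ} (h : IsRoot r l) (hr : 11 / 50 < r) (hr1 : r < 1)
    (hK : 0 < (1 - 4 * r + r ^ 2) / 2) : ∃ c > 0, margin r l = -(c * critPoly r) := by
  obtain ⟨K, hKd⟩ : ∃ K, K = (1 - 4 * r + r ^ 2) / 2 := ⟨_, rfl⟩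
  have hid := critPoly_identity r
  rw [← hKd] at hid hK
  have hr0 : 0 < r := by linarith
  have hx0 : 0 < r ^ 5 / K := by positivity
  have hm : margin r l = K * (r ^ 5 / K - l) := by
    rw [mul_sub, mul_div_cancel₀ _ hK.ne', margin, hKd]
    ring
  have hq : K ^ 3 * q r (r ^ 5 / K) =
      r ^ 10 * (1 - r) ^ 4 * (1 - 6 * r + r ^ 2) / 128 * critPoly r := by
    rw [← hid, q]
    field_simp
  have hf := h.factor_pos hr hx0
  rw [h.q_eq] at hq
  obtain ⟨f, hfd⟩ : ∃ f, f = (r ^ 5 / K) ^ 2 + (l + tr r) * (r ^ 5 / K) + r ^ 11 / l := ⟨_, rfl⟩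
  rw [← hfd] at hq hf
  have h6 : 0 < -(1 - 6 * r + r ^ 2) := by nlinarith
  have h1r : 0 < 1 - r := by linarith
  refine ⟨r ^ 10 * (1 - r) ^ 4 * -(1 - 6 * r + r ^ 2) / 128 / (K ^ 2 * f), by positivity, ?_⟩
  rw [hm]
  field_simp at hq ⊢
  linear_combination hq

theorem IsRoot.margin_pos {r l : ℝ} (h : IsRoot r l) (hr : 11 / 50 < r) (hr1 : r < 1)
    (hc : critPoly r < 0) : 0 < margin r l := by
  rcases le_or_gt ((1 - 4 * r + r ^ 2) / 2) 0 with hK | hK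
  · have h1 : 0 < r ^ 5 := pow_pos (by linarith) 5
    have h2 : 0 ≤ (-1 + 4 * r - r ^ 2) / 2 * l := mul_nonneg (by linarith) h.pos.le
    unfold margin
    linarith
  · obtain ⟨c, hc0, e⟩ := h.margin_identity hr hr1 hK
    rw [e]
    nlinarith

theorem IsRoot.margin_eq_zero {r l : ℝ} (h : IsRoot r l) (hr : 11 / 50 < r) (hr1 : r < 1)
    (hc : critPoly r = 0) : margin r l = 0 := by
  -- At a zero of `critPoly`, 5 - 22r = 2r² + 6r³ - r⁴ > 0; the bound 5/22 makes 1 - 4r + r²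
  -- positive.
  have hr2 : r < 5 / 22 := by
    unfold critPoly at hc
    nlinarith [pow_pos (show 0 < r by linarith) 3, pow_pos (show 0 < r by linarith) 2]
  obtain ⟨c, -, e⟩ := h.margin_identity hr hr1 (by nlinarith)
  rw [e, hc, mul_zero, neg_zero]

/-! ### The eigenline and its normalization. -/

theorem alpha_sq_sub (r : ℝ) : alpha r ^ 2 - r = (1 - r) ^ 2 / 4 := by
  unfold alpha
  ring

theorem alpha_pos {r : ℝ} (hr : 0 < r) : 0 < alpha r := by
  unfold alpha
  linarith

/-- The determinant of the linear system that determines an eigenvector from its first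
coordinate. -/
noncomputable def solvDet (r l : ℝ) : ℝ :=
  (alpha r ^ 2 * r ^ 3 + l) * alpha r * margin r l +
    alpha r * (alpha r ^ 2 - r) * (l ^ 2 - r ^ 8)

theorem IsRoot.sq_sub_pos {r l : ℝ} (h : IsRoot r l) (hr : 11 / 50 < r) : 0 < l ^ 2 - r ^ 8 := by
  have hr0 : 0 < r := by linarith
  have : (r ^ 4) ^ 2 < l ^ 2 := by
    have := h.pow_four_lt hr
    gcongr
  linarith

theorem IsRoot.solvDet_pos {r l : ℝ} (h : IsRoot r l) (hr : 11 / 50 < r) (hr1 : r < 1)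
    (hm : 0 ≤ margin r l) : 0 < solvDet r l := by
  have hr0 : 0 < r := by linarith
  have h1 := alpha_pos hr0
  have h2 := h.sq_sub_pos hr
  have h3 : 0 < alpha r ^ 2 - r := by
    rw [alpha_sq_sub]
    have : 0 < 1 - r := by linarith
    positivity
  have h4 := h.pos
  unfold solvDet
  positivity

theorem EigenRelations.depth_eq {r l : ℝ} {u : Vec} (e : EigenRelations r l u) :
    r * solvDet r l * depth r u = l * (alpha r ^ 2 - r) * (l ^ 2 - r ^ 8) * u 0 := by
  unfold solvDet
  linear_combination (l ^ 2 - r ^ 8) * e.first - r * (alpha r ^ 2 * r ^ 3 + l) * e.ratio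

/-- The relations determine `depth`, then `excess`, then the remaining coordinates from the first
one. So the eigenspace is a line on which u₀ = 1 can be imposed. -/
theorem IsRoot.eq_zero_of_eigenvector {r l : ℝ} (h : IsRoot r l) (hr : 11 / 50 < r) (hr1 : r < 1)
    (hm : 0 ≤ margin r l) {u : Vec} (hu : reducedMatrix r *ᵥ u = (-l) • u) (h0 : u 0 = 0) :
    u = 0 := by
  have hr0 : 0 < r := by linarith
  have e := eigenRelations hr0.ne' hu
  have hB : depth r u = 0 := by
    have := e.depth_eq
    rw [h0, mul_zero] at this
    exact (mul_eq_zero.1 this).resolve_left (mul_pos hr0 (h.solvDet_pos hr hr1 hm)).ne'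
  have hA : excess r u = 0 := by
    have := e.ratio
    rw [hB, mul_zero, zero_mul] at this
    exact (mul_eq_zero.1 this).resolve_left (h.sq_sub_pos hr).ne'
  have h1 : u 1 = 0 := by
    rw [excess, h0, sub_zero] at hA
    exact (mul_eq_zero.1 hA).resolve_left (alpha_pos hr0).ne'
  have h2 : u 2 = 0 := by
    have := e.third
    rw [hA, hB] at this
    simpa [h.pos.ne'] using this
  ext i
  fin_cases i <;> assumption

theorem IsRoot.eigenvector_eq {r l : ℝ} (h : IsRoot r l) (hr : 11 / 50 < r) (hr1 : r < 1)
    (hm : 0 ≤ margin r l) {u v : Vec} (hu : reducedMatrix r *ᵥ u = (-l) • u) (h0 : u 0 = 1)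
    (hv : reducedMatrix r *ᵥ v = (-l) • v) : v = v 0 • u := by
  rw [← sub_eq_zero]
  refine h.eq_zero_of_eigenvector hr hr1 hm ?_ (by simp [h0])
  rw [Matrix.mulVec_sub, Matrix.mulVec_smul, hu, hv, smul_sub, smul_comm]

theorem IsRoot.exists_eigenvector {r l : ℝ} (h : IsRoot r l) (hr : 11 / 50 < r) (hr1 : r < 1)
    (hm : 0 ≤ margin r l) : ∃ u : Vec, reducedMatrix r *ᵥ u = (-l) • u ∧ u 0 = 1 := by
  obtain ⟨v, hv0, hv⟩ := isRoot_charpoly_iff.1 (isRoot_charpoly_neg.2 h.root)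
  have h0 : v 0 ≠ 0 := fun h0 => hv0 (h.eq_zero_of_eigenvector hr hr1 hm hv h0)
  refine ⟨(v 0)⁻¹ • v, ?_, by simp [h0]⟩
  rw [Matrix.mulVec_smul, hv, smul_comm]

theorem isDominatingEigenvector_iff {r l : ℝ} (h : IsRoot r l) (hr : 0 < r) {u : Vec} :
    IsDominatingEigenvector (reducedMatrix r) u ↔
      reducedMatrix r *ᵥ u = (-l) • u ∧ u 0 = 1 := by
  have hd := h.isDominatingEigenvalue hr
  constructor
  · rintro ⟨⟨m, hm, e⟩, h0⟩
    rw [hd.unique hm] at e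
    exact ⟨e, h0⟩
  · rintro ⟨e, h0⟩
    exact ⟨⟨_, hd, e⟩, h0⟩

/-- When the excess vanishes, the relations give u₂ = -1 and rα · `depth` = l. Computing `depth` and
(P₃P₁u)₂ directly from these coordinates and comparing with `coord` eliminates l. No lower bound on
r is needed, which excludes roots on all of ]0,1[. -/
theorem critPoly_eq_zero_of_eigenvector {r l : ℝ} (hr : 0 < r) (hr1 : r < 1) (hl : l ≠ 0) {u : Vec}
    (hu : reducedMatrix r *ᵥ u = (-l) • u) (h0 : u 0 = 1) (h1 : alpha r * u 1 - u 0 = 0) :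
    critPoly r = 0 := by
  have e := eigenRelations hr.ne' hu
  have hA : excess r u = 0 := h1
  have hδ : alpha r ^ 2 - r ≠ 0 := by
    rw [alpha_sq_sub]
    have : 0 < 1 - r := by linarith
    positivity
  have hy : alpha r * u 1 = 1 := by linarith
  have hB : r * alpha r * depth r u = l := by
    have := e.first
    rw [hA, h0] at this
    refine mul_left_cancel₀ hδ ?_
    linear_combination this
  have h2 : u 2 = -1 := by
    have := e.third
    rw [hA] at this
    refine mul_left_cancel₀ hl ?_
    linear_combination this - hB
  have hB' : alpha r * depth r u =
      r * ((alpha r ^ 2 - r) * (1 + alpha r ^ 2) - alpha r ^ 2 * r) := by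
    rw [depth, P3_mulVec', P1_mulVec']
    simp only [h1, h2, Matrix.cons_val]
    linear_combination (alpha r ^ 2 - r) * r * hy
  have hw : (P3 r *ᵥ (P1 r *ᵥ u)) 2 = -r ^ 2 * (1 + alpha r ^ 2 - r) := by
    rw [P3_mulVec', P1_mulVec']
    simp only [h1, h2, Matrix.cons_val]
    linear_combination -r ^ 2 * hy
  have hc := e.coord
  rw [hw, h0] at hc
  have : r ^ 2 * critPoly r = 0 := by
    have hc' : r ^ 2 * (2 * ((alpha r ^ 2 - r) * (1 + alpha r ^ 2) - alpha r ^ 2 * r) -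
        r * (1 + alpha r ^ 2 - r)) = 0 := by
      linear_combination hc + hB - 2 * r * hB'
    unfold alpha at hc'
    unfold critPoly
    linear_combination 8 * hc'
  exact (mul_eq_zero.1 this).resolve_left (by positivity)

/-! ### Homogeneity of the mapping and the open cones of its letters. -/

theorem mul_neg_iff_right {a b : ℝ} (ha : 0 < a) : a * b < 0 ↔ b < 0 :=
  smul_neg_iff_of_pos_left ha

theorem norm2_sq (u : Vec) : norm2 u ^ 2 = u 0 ^ 2 + u 1 ^ 2 + u 2 ^ 2 := by
  have e : u ⬝ᵥ u = u 0 ^ 2 + u 1 ^ 2 + u 2 ^ 2 := by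
    simp [dotProduct, Fin.sum_univ_three]
    ring
  rw [norm2, e, Real.sq_sqrt (by positivity)]

theorem norm2_pos {u : Vec} (hu : u ≠ 0) : 0 < norm2 u := by
  refine lt_of_le_of_ne (Real.sqrt_nonneg _) fun h => hu ?_
  have e := norm2_sq u
  rw [← h] at e
  ext i
  fin_cases i <;> simp <;> nlinarith [sq_nonneg (u 0), sq_nonneg (u 1), sq_nonneg (u 2)]

theorem toSphere_eq_self {u : Vec} (hu : u 0 ^ 2 + u 1 ^ 2 + u 2 ^ 2 = 1) : toSphere u = u := by
  have h : norm2 u = 1 := by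
    have e := norm2_sq u
    rw [hu] at e
    exact (pow_eq_one_iff_of_nonneg (Real.sqrt_nonneg _) two_ne_zero).1 e
  rw [toSphere, h, inv_one, one_smul]

theorem exists_toSphere_eq {u : Vec} (hu : u ≠ 0) : ∃ c : ℝ, 0 < c ∧ toSphere u = c • u :=
  ⟨_, inv_pos.2 (norm2_pos hu), rfl⟩

theorem toSphere_sq {u : Vec} (hu : u ≠ 0) :
    toSphere u 0 ^ 2 + toSphere u 1 ^ 2 + toSphere u 2 ^ 2 = 1 := by
  have h := (norm2_pos hu).ne'
  simp only [toSphere, Pi.smul_apply, smul_eq_mul]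
  field_simp
  exact (norm2_sq u).symm

/-- The quadrant `x ≥ 0, z ≤ 0`. -/
def quadrant : Set Vec := {w | 0 ≤ w 0 ∧ w 2 ≤ 0}

theorem orient_eq_self {w : Vec} (hw : w ∈ quadrant) : orient w = w := by
  exact if_pos hw

theorem smul_mem_quadrant {w : Vec} (hw : w ∈ quadrant) {c : ℝ} (hc : 0 < c) :
    c • w ∈ quadrant := by
  refine ⟨?_, ?_⟩ <;> simp only [Pi.smul_apply, smul_eq_mul]
  · exact mul_nonneg hc.le hw.1
  · exact mul_nonpos_of_nonneg_of_nonpos hc.le hw.2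

theorem letter_smul (r : ℝ) (w : Vec) {c : ℝ} (hc : 0 < c) : letter r (c • w) = letter r w := by
  have h0 : alpha r * (c * w 1) - c * w 0 = c * (alpha r * w 1 - w 0) := by ring
  have h2 : alpha r * (c * w 1) - c * w 2 = c * (alpha r * w 1 - w 2) := by ring
  simp only [letter, Pi.smul_apply, smul_eq_mul, h0, h2, mul_pos_iff_of_pos_left hc,
    mul_neg_iff_right hc]

theorem bMap_smul (r : ℝ) {w : Vec} (hw : w ∈ quadrant) {c : ℝ} (hc : 0 < c) :
    bMap r (c • w) = toSphere ((letter r w).matrix r *ᵥ w) := by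
  rw [bMap, code, orient_eq_self (smul_mem_quadrant hw hc), letter_smul r w hc,
    Matrix.mulVec_smul, toSphere_smul hc]

theorem bMap_toSphere (r : ℝ) {w : Vec} (hw : w ∈ quadrant) (h0 : w ≠ 0) :
    bMap r (toSphere w) = toSphere ((letter r w).matrix r *ᵥ w) := by
  obtain ⟨c, hc, e⟩ := exists_toSphere_eq h0
  rw [e, bMap_smul r hw hc]

theorem code_toSphere (r : ℝ) {w : Vec} (hw : w ∈ quadrant) (h0 : w ≠ 0) :
    code r (toSphere w) = letter r w := by
  obtain ⟨c, hc, e⟩ := exists_toSphere_eq h0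
  rw [e, code, orient_eq_self (smul_mem_quadrant hw hc), letter_smul r w hc]

/-- The open cones on which the collisions denoted by a letter occur without degeneracy. -/
def cell (r : ℝ) : Block → Set Vec
  | .one => {w | (0 < w 0 ∧ w 2 < 0) ∧ 0 < w 1 ∧ 0 < alpha r * w 1 - w 0}
  | .two => {w | (0 < w 0 ∧ w 2 < 0) ∧ w 1 ≠ 0 ∧ alpha r * w 1 - w 0 < 0 ∧
      0 < alpha r * w 1 - w 2}
  | .three => {w | (0 < w 0 ∧ w 2 < 0) ∧ w 1 < 0 ∧ alpha r * w 1 - w 2 < 0}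

theorem isOpen_cell (r : ℝ) (s : Block) : IsOpen (cell r s) := by
  have c0 : Continuous fun w : Vec => w 0 := by fun_prop
  have c1 : Continuous fun w : Vec => w 1 := by fun_prop
  have c2 : Continuous fun w : Vec => w 2 := by fun_prop
  have c3 : Continuous fun w : Vec => alpha r * w 1 - w 0 := by fun_prop
  have c4 : Continuous fun w : Vec => alpha r * w 1 - w 2 := by fun_prop
  have hq : IsOpen {w : Vec | 0 < w 0 ∧ w 2 < 0} :=
    (isOpen_lt continuous_const c0).inter (isOpen_lt c2 continuous_const)
  cases s
  · exact hq.inter ((isOpen_lt continuous_const c1).inter (isOpen_lt continuous_const c3))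
  · exact hq.inter ((isOpen_ne_fun c1 continuous_const).inter
      ((isOpen_lt c3 continuous_const).inter (isOpen_lt continuous_const c4)))
  · exact hq.inter ((isOpen_lt c1 continuous_const).inter (isOpen_lt c4 continuous_const))

theorem pos_of_mem_cell {r : ℝ} {s : Block} {w : Vec} (hw : w ∈ cell r s) :
    0 < w 0 ∧ w 2 < 0 := by
  cases s <;> exact hw.1

theorem mem_quadrant_of_mem_cell {r : ℝ} {s : Block} {w : Vec} (hw : w ∈ cell r s) :
    w ∈ quadrant :=
  ⟨(pos_of_mem_cell hw).1.le, (pos_of_mem_cell hw).2.le⟩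

theorem ne_zero_of_mem_cell {r : ℝ} {s : Block} {w : Vec} (hw : w ∈ cell r s) : w ≠ 0 := by
  rintro rfl
  exact lt_irrefl _ (pos_of_mem_cell hw).1

theorem smul_mem_cell {r : ℝ} {s : Block} {w : Vec} (hw : w ∈ cell r s) {c : ℝ} (hc : 0 < c) :
    c • w ∈ cell r s := by
  have h0 : alpha r * (c * w 1) - c * w 0 = c * (alpha r * w 1 - w 0) := by ring
  have h2 : alpha r * (c * w 1) - c * w 2 = c * (alpha r * w 1 - w 2) := by ring
  cases s <;>
    simpa only [cell, mem_ofPred_eq, Pi.smul_apply, smul_eq_mul, h0, h2,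
      mul_pos_iff_of_pos_left hc, mul_neg_iff_right hc, ne_eq, mul_eq_zero, hc.ne',
      false_or] using hw

theorem letter_of_mem_cell {r : ℝ} {s : Block} {w : Vec} (hw : w ∈ cell r s) :
    letter r w = s := by
  cases s
  · exact if_pos hw.2
  · obtain ⟨-, -, h1, h2⟩ := hw
    rw [letter, if_neg (fun h => lt_asymm h.2 h1), if_neg (fun h => lt_asymm h.2 h2)]
  · obtain ⟨-, h1, h2⟩ := hw
    rw [letter, if_neg (fun h => lt_asymm h.1 h1), if_pos ⟨h1, h2⟩]

theorem toSphere_mem_domX {w : Vec} (hw : w ∈ quadrant) (h0 : w ≠ 0) : toSphere w ∈ domX := by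
  refine ⟨toSphere_sq h0, Or.inl ?_⟩
  obtain ⟨c, hc, e⟩ := exists_toSphere_eq h0
  rw [e]
  exact smul_mem_quadrant hw hc

/-- Inside a cell, the letter describes the collisions. -/
theorem collisions_of_mem_cell {r : ℝ} (hr : 0 < r) {s : Block} {w : Vec} (hw : w ∈ cell r s) :
    ∃ c ∈ s.words, ∃ u' : Vec,
      bToB r (toSphere w) = some (c, u') ∧ toSphere u' = bMap r (toSphere w) := by
  have ha := alpha_pos hr
  have h0 := ne_zero_of_mem_cell hw
  have hd := toSphere_mem_domX (mem_quadrant_of_mem_cell hw) h0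
  have hcode := code_toSphere r (mem_quadrant_of_mem_cell hw) h0
  obtain ⟨c, hc, e⟩ := exists_toSphere_eq h0
  rw [letter_of_mem_cell hw, e] at hcode
  rw [e] at hd ⊢
  have hw' := smul_mem_cell hw hc
  rw [← hcode]
  have hp := pos_of_mem_cell hw'
  apply bMap_eq_collisions hr hd hp.1.ne' ?_ hp.2.ne ?_ ?_
  all_goals
    cases s
    all_goals simp only [cell, mem_ofPred_eq] at hw'
  · exact hw'.2.1.ne'
  · exact hw'.2.1
  · exact hw'.2.1.ne
  · exact hw'.2.2.ne'
  · exact hw'.2.2.1.ne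
  · nlinarith [hw'.2.1]
  · nlinarith [hw'.2.1]
  · exact hw'.2.2.2.ne'
  · exact hw'.2.2.ne

/-! ### Words, matrix products and the mirror symmetry. -/

/-- The product of the matrices of the first `n` letters of a word. -/
noncomputable def prefixProd (r : ℝ) (s : ℕ → Block) : ℕ → Matrix (Fin 3) (Fin 3) ℝ
  | 0 => 1
  | n + 1 => (s n).matrix r * prefixProd r s n

theorem prefixProd_add (r : ℝ) {s : ℕ → Block} {p : ℕ} (hs : ∀ n, s (n + p) = s n) (n : ℕ) :
    prefixProd r s (n + p) = prefixProd r s n * prefixProd r s p := by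
  induction n with
  | zero => simp [prefixProd]
  | succ n ih => rw [Nat.succ_add, prefixProd, prefixProd, ih, hs, Matrix.mul_assoc]

theorem prefixProd_add_mul (r : ℝ) {s : ℕ → Block} {p : ℕ} (hs : ∀ n, s (n + p) = s n)
    (n k : ℕ) : prefixProd r s (k + p * n) = prefixProd r s k * prefixProd r s p ^ n := by
  induction n with
  | zero => simp
  | succ n ih =>
    rw [mul_add, mul_one, ← add_assoc, prefixProd_add r hs, ih, pow_succ, Matrix.mul_assoc]

/-- Letters and directions are insensitive to positive scaling, so the normalizations can be
postponed to the end. -/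
theorem iterate_bMap_toSphere {r : ℝ} {s : ℕ → Block} {w : Vec}
    (hw : ∀ n, prefixProd r s n *ᵥ w ∈ cell r (s n)) (n : ℕ) :
    (bMap r)^[n] (toSphere w) = toSphere (prefixProd r s n *ᵥ w) := by
  induction n with
  | zero => simp [prefixProd]
  | succ n ih =>
    rw [Function.iterate_succ_apply', ih, bMap_toSphere r (mem_quadrant_of_mem_cell (hw n))
      (ne_zero_of_mem_cell (hw n)), letter_of_mem_cell (hw n), prefixProd, Matrix.mulVec_mulVec]

/-- The periodic word `132312132312…`. -/
def word (n : ℕ) : Block := pattern132312 (Fin.ofNat 6 n)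

theorem word_add_six (n : ℕ) : word (n + 6) = word n := by
  simp [word, Fin.ofNat]

theorem word_fin (k : Fin 6) : word k = pattern132312 k := by
  simp [word]

theorem J_mul_J : J * J = 1 := by
  ext i j
  fin_cases i <;> fin_cases j <;> simp [J, Matrix.mul_apply, Fin.sum_univ_three]

theorem P1_mul_J (r : ℝ) : P1 r * J = J * P3 r := by
  ext i j
  fin_cases i <;> fin_cases j <;> simp [J, P1, P3, Matrix.mul_apply, Fin.sum_univ_three]

theorem P2_mul_J (r : ℝ) : P2 r * J = J * P2 r := by
  ext i j
  fin_cases i <;> fin_cases j <;> simp [J, P2, Matrix.mul_apply, Fin.sum_univ_three]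

theorem P3_mul_J (r : ℝ) : P3 r * J = J * P1 r := by
  ext i j
  fin_cases i <;> fin_cases j <;> simp [J, P1, P3, Matrix.mul_apply, Fin.sum_univ_three]

theorem prefixProd_three (r : ℝ) : prefixProd r word 3 = J * reducedMatrix r := by
  have : prefixProd r word 3 = P2 r * (P3 r * (P1 r * 1)) := rfl
  rw [this, reducedMatrix]
  simp only [← Matrix.mul_assoc, J_mul_J, mul_one, one_mul]

/-- The second half-period 312 mirrors the first, so moving J through it exchanges P₁ and P₃ and
reproduces the reduced matrix. -/
theorem prefixProd_six (r : ℝ) : prefixProd r word 6 = reducedMatrix r ^ 2 := by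
  have : prefixProd r word 6 = P2 r * (P1 r * (P3 r * prefixProd r word 3)) := rfl
  rw [this, prefixProd_three, pow_two]
  have h1 : P3 r * (J * reducedMatrix r) = J * (P1 r * reducedMatrix r) := by
    rw [← Matrix.mul_assoc, P3_mul_J, Matrix.mul_assoc]
  have h2 : P1 r * (J * (P1 r * reducedMatrix r)) = J * (P3 r * (P1 r * reducedMatrix r)) := by
    rw [← Matrix.mul_assoc, P1_mul_J, Matrix.mul_assoc]
  have h3 : P2 r * (J * (P3 r * (P1 r * reducedMatrix r))) =
      J * (P2 r * (P3 r * (P1 r * reducedMatrix r))) := by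
    rw [← Matrix.mul_assoc, P2_mul_J, Matrix.mul_assoc]
  rw [h1, h2, h3, reducedMatrix]
  simp only [Matrix.mul_assoc]

/-- The exchange of the letters `1` and `3`. -/
def mirror : Block → Block
  | .one => .three
  | .two => .two
  | .three => .one

theorem mirror_matrix_mul_J (r : ℝ) (s : Block) : (mirror s).matrix r * J = J * s.matrix r := by
  cases s
  · exact P3_mul_J r
  · exact P2_mul_J r
  · exact P1_mul_J r

/-- J exchanges x and z, and the sign brings the vector back to the quadrant x ≥ 0, z ≤ 0. -/
theorem neg_J_mem_cell {r : ℝ} {s : Block} {w : Vec} (hw : w ∈ cell r s) :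
    -(J *ᵥ w) ∈ cell r (mirror s) := by
  rw [J_mulVec]
  cases s <;> simp [cell, mirror] at hw ⊢
  · exact ⟨⟨hw.1.2, hw.1.1⟩, hw.2.1, hw.2.2⟩
  · exact ⟨⟨hw.1.2, hw.1.1⟩, hw.2.1, hw.2.2.2, hw.2.2.1⟩
  · exact ⟨⟨hw.1.2, hw.1.1⟩, hw.2.1, hw.2.2⟩

theorem word_add_three (n : ℕ) : word (n + 3) = mirror (word n) := by
  have h : ∀ k : Fin 6, pattern132312 (k + 3) = mirror (pattern132312 k) := by
    intro k
    fin_cases k <;> rfl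
  have e : (Fin.ofNat 6 (n + 3) : Fin 6) = Fin.ofNat 6 n + 3 := by
    ext
    simp [Fin.ofNat, Fin.val_add]
  rw [word, word, e, h]

theorem prefixProd_add_three (r : ℝ) (n : ℕ) :
    prefixProd r word (n + 3) = J * prefixProd r word n * reducedMatrix r := by
  induction n with
  | zero => rw [zero_add, prefixProd_three, prefixProd, mul_one]
  | succ n ih =>
    rw [Nat.succ_add, prefixProd, ih, word_add_three, prefixProd, ← Matrix.mul_assoc,
      ← Matrix.mul_assoc, mirror_matrix_mul_J, Matrix.mul_assoc J]

/-- Three letters later the vector is -lJ times the earlier one: a positive multiple of its mirror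
image. This is where the negative sign of the eigenvalue matters. -/
theorem mem_cell_of_eigenvector {r l : ℝ} (hl : 0 < l) {u : Vec}
    (hu : reducedMatrix r *ᵥ u = (-l) • u) (h0 : u ∈ cell r .one)
    (h1 : P1 r *ᵥ u ∈ cell r .three) (h2 : P3 r *ᵥ (P1 r *ᵥ u) ∈ cell r .two) (n : ℕ) :
    prefixProd r word n *ᵥ u ∈ cell r (word n) := by
  induction n using Nat.strong_induction_on with
  | _ n ih =>
    match n with
    | 0 =>
      rw [prefixProd, Matrix.one_mulVec]
      exact h0
    | 1 =>
      have : prefixProd r word 1 = P1 r * 1 := rfl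
      rw [this, mul_one]
      exact h1
    | 2 =>
      have : prefixProd r word 2 = P3 r * (P1 r * 1) := rfl
      rw [this, mul_one, ← Matrix.mulVec_mulVec]
      exact h2
    | n + 3 =>
      have h := smul_mem_cell (neg_J_mem_cell (ih n (by omega))) hl
      rw [word_add_three, prefixProd_add_three, ← Matrix.mulVec_mulVec, hu, Matrix.mulVec_smul,
        ← Matrix.mulVec_mulVec, neg_smul, ← smul_neg]
      exact h

theorem IsRoot.mem_cell {r l : ℝ} (h : IsRoot r l) (hr : 11 / 50 < r) (hr1 : r < 1)
    (hm : 0 < margin r l) {u : Vec} (hu : reducedMatrix r *ᵥ u = (-l) • u) (h0 : u 0 = 1) (n : ℕ) :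
    prefixProd r word n *ᵥ u ∈ cell r (word n) := by
  have hr0 : 0 < r := by linarith
  have ha := alpha_pos hr0
  have hl := h.pos
  have e := eigenRelations hr0.ne' hu
  have hδ : 0 < alpha r ^ 2 - r := by
    rw [alpha_sq_sub]
    have : 0 < 1 - r := by linarith
    positivity
  have hB : 0 < depth r u := by
    have h1 : 0 < r * solvDet r l := mul_pos hr0 (h.solvDet_pos hr hr1 hm.le)
    refine pos_of_mul_pos_right (b := depth r u) ?_ h1.le
    rw [e.depth_eq, h0]
    have := h.sq_sub_pos hr
    positivity
  have hA : 0 < excess r u := by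
    refine pos_of_mul_pos_right (b := excess r u) ?_ (h.sq_sub_pos hr).le
    rw [e.ratio]
    positivity
  have h2 : u 2 < 0 := by
    have : l * u 2 < 0 := by
      rw [e.third]
      have : 0 < r * (r ^ 3 * excess r u + alpha r * depth r u) := by positivity
      linarith
    exact (mul_neg_iff_right hl).1 this
  have hy : 0 < u 1 := by
    have : 0 < alpha r * u 1 := by
      unfold excess at hA
      linarith
    exact pos_of_mul_pos_right this ha.le
  have w0 : (P3 r *ᵥ (P1 r *ᵥ u)) 0 = r ^ 3 * excess r u := by
    rw [P3_mulVec', P1_mulVec', excess]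
    simp
    ring
  have w1 : (P3 r *ᵥ (P1 r *ᵥ u)) 1 = -depth r u := by
    rw [depth, neg_neg]
  have w2 := e.coord
  rw [h0, mul_one] at w2
  have w2neg : (P3 r *ᵥ (P1 r *ᵥ u)) 2 < 0 := by
    have : r * (P3 r *ᵥ (P1 r *ᵥ u)) 2 < 0 := by
      rw [w2]
      have : 0 < r * alpha r * depth r u := by positivity
      linarith
    exact (mul_neg_iff_right hr0).1 this
  have w0pos : 0 < (P3 r *ᵥ (P1 r *ᵥ u)) 0 := by
    rw [w0]
    positivity
  have v0 : 0 < (P1 r *ᵥ u) 0 := by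
    rw [P1_mulVec']
    exact mul_pos hr0 hA
  have v2 : (P1 r *ᵥ u) 2 < 0 := by
    rw [P1_mulVec']
    exact mul_neg_of_pos_of_neg (by positivity) h2
  -- Multiplied by r, this difference is the last coordinate of P₃P₁u.
  have v12 : alpha r * (P1 r *ᵥ u) 1 - (P1 r *ᵥ u) 2 < 0 := by
    have := w2neg
    rw [P3_mulVec'] at this
    exact (mul_neg_iff_right hr0).1 this
  have v1 : (P1 r *ᵥ u) 1 < 0 := (mul_neg_iff_right ha).1 (by linarith)
  refine mem_cell_of_eigenvector hl hu ⟨⟨by rw [h0]; exact one_pos, h2⟩, hy, hA⟩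
    ⟨⟨v0, v2⟩, v1, v12⟩ ⟨⟨w0pos, w2neg⟩, ?_, ?_, ?_⟩ n
  · rw [w1]
    linarith
  · rw [w1]
    nlinarith
  -- By `coord`, r times the quantity to be shown positive equals l.
  · rw [w1]
    refine pos_of_mul_pos_right (a := r) ?_ hr0.le
    linarith

/-! ### Uniqueness of the point that generates the pattern. -/

theorem matrix_mulVec_ne_zero {r : ℝ} (hr : 0 < r) (s : Block) {w : Vec} (hw : w ≠ 0) :
    s.matrix r *ᵥ w ≠ 0 := by
  intro h
  refine hw (Matrix.eq_zero_of_mulVec_eq_zero ?_ h)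
  cases s
  · have : (P1 r).det = r ^ 4 := by
      simp [P1, Matrix.det_fin_three]
      ring
    rw [Block.matrix, this]
    positivity
  · have : (P2 r).det = r ^ 3 := by
      simp [P2, Matrix.det_fin_three]
      ring
    rw [Block.matrix, this]
    positivity
  · have : (P3 r).det = r ^ 4 := by
      simp [P3, Matrix.det_fin_three]
      ring
    rw [Block.matrix, this]
    positivity

theorem letter_matrix_mulVec_mem_quadrant {r : ℝ} (hr : 0 < r) {w : Vec} (hw : w ∈ quadrant) :
    (letter r w).matrix r *ᵥ w ∈ quadrant := by
  have ha := alpha_pos hr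
  obtain ⟨hx, hz⟩ := hw
  unfold letter
  split_ifs with h1 h3
  · rw [Block.matrix, P1_mulVec']
    exact ⟨(mul_pos hr h1.2).le, mul_nonpos_of_nonneg_of_nonpos (sq_nonneg r) hz⟩
  · rw [Block.matrix, P3_mulVec']
    exact ⟨mul_nonneg (sq_nonneg r) hx, (mul_neg_of_pos_of_neg hr h3.2).le⟩
  · have hx' : alpha r * w 1 - w 0 ≤ 0 := by
      rcases le_or_gt (w 1) 0 with h | h
      · nlinarith
      · exact not_lt.1 fun h' => h1 ⟨h, h'⟩
    have hz' : 0 ≤ alpha r * w 1 - w 2 := by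
      rcases le_or_gt 0 (w 1) with h | h
      · nlinarith
      · exact not_lt.1 fun h' => h3 ⟨h, h'⟩
    rw [Block.matrix, P2_mulVec']
    exact ⟨neg_nonneg.2 (mul_nonpos_of_nonneg_of_nonpos hr.le hx'),
      neg_nonpos.2 (mul_nonneg hr.le hz')⟩

theorem orient_mem_quadrant {v : Vec} (hv : v ∈ domX) : orient v ∈ quadrant := by
  unfold orient
  split_ifs with h
  · exact h
  · have := hv.2.resolve_left h
    exact ⟨neg_nonneg.2 this.1, neg_nonpos.2 this.2⟩

theorem ne_zero_of_mem_domX {v : Vec} (hv : v ∈ domX) : v ≠ 0 := by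
  rintro rfl
  simpa using hv.1

theorem orient_ne_zero {v : Vec} (hv : v ≠ 0) : orient v ≠ 0 := by
  unfold orient
  split_ifs
  · exact hv
  · exact neg_ne_zero.2 hv

/-- Each matrix applied keeps the quadrant, so reorientation can occur only at the start. As v may
be the opposite of `orient v`, the last equality requires n ≠ 0; applying the mapping once more
removes the ambiguity. -/
theorem GeneratesPattern.prefixProd_mulVec {r : ℝ} (hr : 0 < r) {v : Vec}
    (h : GeneratesPattern r pattern132312 v) (n : ℕ) (hn : n ≤ 6) :
    prefixProd r word n *ᵥ orient v ∈ quadrant ∧ prefixProd r word n *ᵥ orient v ≠ 0 ∧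
      (n < 6 → letter r (prefixProd r word n *ᵥ orient v) = word n) ∧
      bMap r ((bMap r)^[n] v) = bMap r (toSphere (prefixProd r word n *ᵥ orient v)) ∧
      (n ≠ 0 → (bMap r)^[n] v = toSphere (prefixProd r word n *ᵥ orient v)) := by
  have hq := orient_mem_quadrant h.1
  have h0 := orient_ne_zero (ne_zero_of_mem_domX h.1)
  induction n with
  | zero =>
    rw [prefixProd, Matrix.one_mulVec]
    refine ⟨hq, h0, fun _ => h.2.1 0, ?_, fun h => absurd rfl h⟩
    rw [bMap_toSphere r hq h0]
    rfl
  | succ n ih =>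
    obtain ⟨iq, i0, il, ib, -⟩ := ih (by omega)
    have hl := il (by omega)
    have e : (bMap r)^[n + 1] v = toSphere (prefixProd r word (n + 1) *ᵥ orient v) := by
      rw [Function.iterate_succ_apply', ib, bMap_toSphere r iq i0, hl, prefixProd,
        ← Matrix.mulVec_mulVec]
    have hq' : prefixProd r word (n + 1) *ᵥ orient v ∈ quadrant := by
      have := letter_matrix_mulVec_mem_quadrant hr iq
      rwa [hl, Matrix.mulVec_mulVec] at this
    have h0' : prefixProd r word (n + 1) *ᵥ orient v ≠ 0 := by
      have := matrix_mulVec_ne_zero hr (word n) i0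
      rwa [Matrix.mulVec_mulVec] at this
    refine ⟨hq', h0', fun hlt => ?_, by rw [e], fun _ => e⟩
    have hc := h.2.1 ⟨n + 1, hlt⟩
    rw [← code_toSphere r hq' h0', ← e, ← word_fin] at *
    exact hc

/-- A point that generates the pattern is a positive multiple of the dominating eigenvector. -/
theorem GeneratesPattern.eq_toSphere {r l : ℝ} (h : IsRoot r l) (hr : 11 / 50 < r) (hr1 : r < 1)
    (hm : 0 ≤ margin r l) {u v : Vec} (hu : reducedMatrix r *ᵥ u = (-l) • u) (h0 : u 0 = 1)
    (hv : GeneratesPattern r pattern132312 v) : v = toSphere u := by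
  have hr0 : 0 < r := by linarith
  have hv0 := ne_zero_of_mem_domX hv.1
  obtain ⟨q6, n6, -, -, e6⟩ := hv.prefixProd_mulVec hr0 6 le_rfl
  have e6 := (e6 (by norm_num)).symm.trans hv.2.2
  obtain ⟨c, hc, ec⟩ := exists_toSphere_eq n6
  rw [ec] at e6
  have hvq : v ∈ quadrant := e6 ▸ smul_mem_quadrant q6 hc
  have ho := orient_eq_self hvq
  have hl0 := (hv.prefixProd_mulVec hr0 0 (by norm_num)).2.2.1 (by norm_num)
  have hl1 := (hv.prefixProd_mulVec hr0 1 (by norm_num)).2.2.1 (by norm_num)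
  have h3 := (hv.prefixProd_mulVec hr0 3 (by norm_num)).1
  have hp1 : prefixProd r word 1 = P1 r := mul_one (P1 r)
  rw [ho, prefixProd, Matrix.one_mulVec] at hl0
  rw [ho, hp1] at hl1
  rw [ho, prefixProd_three, ← Matrix.mulVec_mulVec, J_mulVec] at h3
  rw [ho, prefixProd_six, pow_two, ← Matrix.mulVec_mulVec] at e6
  have hy : 0 < v 1 := by
    by_contra hy
    unfold letter at hl0
    rw [if_neg (fun h' => hy h'.1)] at hl0
    split_ifs at hl0 <;> simp [word, pattern132312] at hl0
  have hy1 : (P1 r *ᵥ v) 1 < 0 := by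
    by_contra hy
    unfold letter at hl1
    rw [if_neg (c := (P1 r *ᵥ v) 1 < 0 ∧ _) (fun h' => hy h'.1)] at hl1
    split_ifs at hl1 <;> simp [word, pattern132312, Fin.ofNat] at hl1
  -- Periodicity says c M²v = v, that is M²v = m²v. Then Mv - mv and Mv + mv are each zero or an
  -- eigenvector, for -m and m respectively.
  obtain ⟨m, hm0, hmc⟩ : ∃ m : ℝ, 0 < m ∧ m ^ 2 = c⁻¹ :=
    ⟨√c⁻¹, Real.sqrt_pos.2 (inv_pos.2 hc), Real.sq_sqrt (inv_pos.2 hc).le⟩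
  have hM : reducedMatrix r *ᵥ (reducedMatrix r *ᵥ v) = m ^ 2 • v := by
    rw [hmc]
    nth_rewrite 2 [← e6]
    rw [smul_smul, inv_mul_cancel₀ hc.ne', one_smul]
  have hneg : ∀ w : Vec, w ≠ 0 → reducedMatrix r *ᵥ w = (-m) • w → m = l := fun w hw e =>
    h.eq_of_q_eq_zero hr hm0 (isRoot_charpoly_neg.1 (isRoot_charpoly_iff.2 ⟨w, hw, e⟩))
  have hsum : reducedMatrix r *ᵥ (reducedMatrix r *ᵥ v + m • v) =
      m • (reducedMatrix r *ᵥ v + m • v) := by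
    rw [Matrix.mulVec_add, Matrix.mulVec_smul, hM, smul_add, smul_smul, pow_two, add_comm]
  have hdiff : reducedMatrix r *ᵥ (reducedMatrix r *ᵥ v - m • v) =
      (-m) • (reducedMatrix r *ᵥ v - m • v) := by
    rw [Matrix.mulVec_sub, Matrix.mulVec_smul, hM]
    module
  -- If Mv = mv, both v and Jv would lie in the quadrant, so v would be on the y-axis. The letter 1
  -- requires y > 0 and the next letter 3 requires (P₁v)₁ < 0, yet (P₁v)₁ = (α² - r)y ≥ 0.
  have hposm : reducedMatrix r *ᵥ v ≠ m • v := by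
    intro e
    rw [e] at h3
    obtain ⟨h30, h32⟩ := h3
    simp only [Pi.smul_apply, smul_eq_mul, Matrix.cons_val] at h30 h32
    have hz : v 2 = 0 := le_antisymm hvq.2 (nonneg_of_mul_nonneg_right h30 hm0)
    have hx : v 0 = 0 := le_antisymm (nonpos_of_mul_nonpos_right h32 hm0) hvq.1
    rw [P1_mulVec'] at hy1
    simp only [hx, hz, Matrix.cons_val] at hy1
    have hδ : 0 ≤ (alpha r ^ 2 - r) * v 1 := by
      rw [alpha_sq_sub]
      positivity
    linarith
  have hml : m = l := hneg _ (sub_ne_zero.2 hposm) hdiff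
  -- Otherwise m = l would be an eigenvalue of the same modulus as the dominating eigenvalue -l.
  have hzero : reducedMatrix r *ᵥ v + m • v = 0 := by
    by_contra hne
    have hd := h.isDominatingEigenvalue hr0
    have := hd.abs_lt (isRoot_charpoly_iff.2 ⟨_, hne, hsum⟩) (by linarith)
    rw [abs_neg, hml] at this
    exact lt_irrefl _ this
  have hev : reducedMatrix r *ᵥ v = (-l) • v := by
    rw [← hml, neg_smul]
    exact eq_neg_of_add_eq_zero_left hzero
  have e := h.eigenvector_eq hr hr1 hm hu h0 hev
  have hpos : 0 < v 0 := by
    refine lt_of_le_of_ne hvq.1 fun h' => hv0 ?_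
    rw [e, ← h', zero_smul]
  rw [← toSphere_eq_self hv.1.1]
  rw [e, toSphere_smul hpos]

theorem IsRoot.generatesPattern {r l : ℝ} (h : IsRoot r l) (hr : 11 / 50 < r) (hr1 : r < 1)
    (hm : 0 < margin r l) {u : Vec} (hu : reducedMatrix r *ᵥ u = (-l) • u) (h0 : u 0 = 1) :
    GeneratesPattern r pattern132312 (toSphere u) := by
  have hc := h.mem_cell hr hr1 hm hu h0
  have hu0 : u ∈ cell r (word 0) := by
    have := hc 0
    rwa [prefixProd, Matrix.one_mulVec] at this
  refine ⟨toSphere_mem_domX (mem_quadrant_of_mem_cell hu0) (ne_zero_of_mem_cell hu0),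
    fun k => ?_, ?_⟩
  · rw [iterate_bMap_toSphere hc, code_toSphere r (mem_quadrant_of_mem_cell (hc k))
      (ne_zero_of_mem_cell (hc k)), letter_of_mem_cell (hc k), word_fin]
  · rw [iterate_bMap_toSphere hc, prefixProd_six, pow_two, ← Matrix.mulVec_mulVec, hu,
      Matrix.mulVec_smul, hu, smul_smul, neg_mul_neg, toSphere_smul (mul_pos h.pos h.pos)]

theorem IsRoot.collisionsFollow {r l : ℝ} (h : IsRoot r l) (hr : 11 / 50 < r) (hr1 : r < 1)
    (hm : 0 < margin r l) {u : Vec} (hu : reducedMatrix r *ᵥ u = (-l) • u) (h0 : u 0 = 1) :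
    CollisionsFollow r pattern132312 (toSphere u) := by
  have hc := h.mem_cell hr hr1 hm hu h0
  intro k
  rw [iterate_bMap_toSphere hc, ← word_fin]
  exact collisions_of_mem_cell (by linarith) (hc k)

/-! ### Convergence of normalized matrix powers. -/

/-- A solution of a linear recurrence of order two tends to zero when both characteristic roots
lie in the open unit disk. -/
theorem tendsto_zero_of_recurrence {a : ℕ → ℂ} {m₁ m₂ : ℂ} (h₁ : ‖m₁‖ < 1) (h₂ : ‖m₂‖ < 1)
    (ha : ∀ n, a (n + 2) = (m₁ + m₂) * a (n + 1) - m₁ * m₂ * a n) :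
    Tendsto a atTop (𝓝 0) := by
  obtain ⟨ρ, hρ0, hρ1, hρ₁, hρ₂⟩ : ∃ ρ : ℝ, 0 < ρ ∧ ρ < 1 ∧ ‖m₁‖ ≤ ρ ∧ ‖m₂‖ ≤ ρ :=
    ⟨max (1 / 2) (max ‖m₁‖ ‖m₂‖), lt_max_of_lt_left (by norm_num),
      max_lt (by norm_num) (max_lt h₁ h₂), by simp, by simp⟩
  -- Removing one root leaves a geometric sequence of ratio m₂. Summing back yields a bound of order
  -- n ρⁿ, which also covers the case m₁ = m₂.
  have hb : ∀ n, ‖a (n + 1) - m₁ * a n‖ ≤ ρ ^ n * ‖a 1 - m₁ * a 0‖ := by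
    intro n
    induction n with
    | zero => simp
    | succ n ih =>
      have e : a (n + 1 + 1) - m₁ * a (n + 1) = m₂ * (a (n + 1) - m₁ * a n) := by
        rw [ha]
        ring
      rw [e, norm_mul]
      calc ‖m₂‖ * ‖a (n + 1) - m₁ * a n‖ ≤ ρ * (ρ ^ n * ‖a 1 - m₁ * a 0‖) := by gcongr
        _ = _ := by ring
  obtain ⟨D, hD⟩ : ∃ D, D = ‖a 1 - m₁ * a 0‖ / ρ := ⟨_, rfl⟩
  have hD' : ‖a 1 - m₁ * a 0‖ = D * ρ := by
    rw [hD]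
    field_simp
  have hbound : ∀ n : ℕ, ‖a n‖ ≤ ρ ^ n * (‖a 0‖ + n * D) := by
    intro n
    induction n with
    | zero => simp
    | succ n ih =>
      have e : a (n + 1) = m₁ * a n + (a (n + 1) - m₁ * a n) := by ring
      calc ‖a (n + 1)‖ ≤ ‖m₁ * a n‖ + ‖a (n + 1) - m₁ * a n‖ := by
            nth_rewrite 1 [e]
            exact norm_add_le _ _
        _ ≤ ρ * (ρ ^ n * (‖a 0‖ + n * D)) + ρ ^ n * (D * ρ) := by
            rw [norm_mul, ← hD']
            gcongr
            exact hb n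
        _ = _ := by
            push_cast
            ring
  refine squeeze_zero_norm hbound ?_
  have t1 := (tendsto_pow_atTop_nhds_zero_of_lt_one hρ0.le hρ1).mul_const ‖a 0‖
  have t2 := (tendsto_self_mul_const_pow_of_lt_one hρ0.le hρ1).mul_const D
  have := t1.add t2
  simp only [zero_mul, add_zero] at this
  refine this.congr fun n => ?_
  ring

/-- The powers of a matrix, divided by the powers of its dominating eigenvalue, converge. -/
theorem IsDominatingEigenvalue.exists_tendsto {M : Matrix (Fin 3) (Fin 3) ℝ} {l : ℝ}
    (h : IsDominatingEigenvalue M l) (hl : l ≠ 0) :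
    ∃ E : Matrix (Fin 3) (Fin 3) ℝ, Tendsto (fun n : ℕ => (l⁻¹ • M) ^ n) atTop (𝓝 E) := by
  obtain ⟨t, s, d, hM⟩ : ∃ t s d : ℝ, M.charpoly = Polynomial.X ^ 3 -
      Polynomial.C t * Polynomial.X ^ 2 + Polynomial.C s * Polynomial.X - Polynomial.C d :=
    ⟨_, _, _, charpoly_fin_three M⟩
  obtain ⟨S, hS⟩ : ∃ S, t = S + l := ⟨t - l, by ring⟩
  obtain ⟨p, hp⟩ : ∃ p, s = p + l * S := ⟨s - l * S, by ring⟩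
  have hd : d = l * p := by
    have := h.isRoot
    rw [hM, hS, hp] at this
    simp at this
    linear_combination -this
  have hfac : M.charpoly = (Polynomial.X - Polynomial.C l) *
      (Polynomial.X ^ 2 - Polynomial.C S * Polynomial.X + Polynomial.C p) := by
    rw [hM, hS, hp, hd]
    simp
    ring
  have hne : l ^ 2 - S * l + p ≠ 0 := by
    intro h0
    have h1 := h.1
    have hc := M.charpoly_monic.ne_zero
    rw [hfac] at h1 hc
    rw [Polynomial.rootMultiplicity_mul hc, Polynomial.rootMultiplicity_X_sub_C_self] at h1
    have : 0 < (Polynomial.X ^ 2 - Polynomial.C S * Polynomial.X +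
        Polynomial.C p).rootMultiplicity l :=
      (Polynomial.rootMultiplicity_pos (right_ne_zero_of_mul hc)).2 (by simpa using h0)
    omega
  have hroot : ∀ m : ℂ, m ^ 2 - S * m + p = 0 → ‖m / l‖ < 1 := by
    intro m hm
    have hml : m ≠ l := by
      rintro rfl
      exact hne (by exact_mod_cast hm)
    have := h.2 m (by rw [hfac, map_mul]; simp [hm]) hml
    rw [norm_div, Complex.norm_real, Real.norm_eq_abs]
    exact (div_lt_one (abs_pos.2 hl)).2 this
  obtain ⟨w, hw⟩ := IsAlgClosed.exists_pow_nat_eq ((S : ℂ) ^ 2 - 4 * p) two_pos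
  have hm₁ := hroot ((S + w) / 2) (by linear_combination hw / 4)
  have hm₂ := hroot ((S - w) / 2) (by linear_combination hw / 4)
  have hcl : (l : ℂ) ≠ 0 := by exact_mod_cast hl
  obtain ⟨T, hT⟩ : ∃ T, T = l⁻¹ • M := ⟨_, rfl⟩
  have hMT : M = l • T := by rw [hT, smul_smul, mul_inv_cancel₀ hl, one_smul]
  -- By Cayley–Hamilton MQ = lQ, so Q divided by l² - Sl + p is the spectral projector for l. Its
  -- complement F is annihilated by Q, whence the recurrence of order two for TⁿF.
  obtain ⟨Q, hQ⟩ : ∃ Q, Q = M ^ 2 - S • M + p • (1 : Matrix (Fin 3) (Fin 3) ℝ) := ⟨_, rfl⟩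
  have hMQ : M * Q = l • Q := by
    have := M.aeval_self_charpoly
    rw [hfac, map_mul] at this
    simp only [map_sub, map_add, map_mul, map_pow, Polynomial.aeval_X, Polynomial.aeval_C,
      Algebra.algebraMap_eq_smul_one, smul_mul_assoc, one_mul] at this
    rw [← hQ, sub_mul, smul_mul_assoc, one_mul, sub_eq_zero] at this
    exact this
  have hQQ : Q * Q = (l ^ 2 - S * l + p) • Q := by
    nth_rewrite 1 [hQ]
    rw [add_mul, sub_mul, pow_two, mul_assoc, smul_mul_assoc, smul_mul_assoc, one_mul, hMQ,
      mul_smul_comm, hMQ]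
    module
  obtain ⟨F, hF⟩ : ∃ F, F = 1 - (l ^ 2 - S * l + p)⁻¹ • Q := ⟨_, rfl⟩
  have hQF : Q * F = 0 := by
    rw [hF, mul_sub, mul_one, mul_smul_comm, hQQ, smul_smul, inv_mul_cancel₀ hne, one_smul,
      sub_self]
  have hTF : T * (T * F) = (S / l) • (T * F) - (p / l ^ 2) • F := by
    have : Q * F = l ^ 2 • (T * (T * F) - ((S / l) • (T * F) - (p / l ^ 2) • F)) := by
      rw [hQ, hMT, add_mul, sub_mul, pow_two]
      simp only [smul_mul_assoc, mul_smul_comm, one_mul, smul_smul, smul_sub, mul_assoc]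
      have e1 : l ^ 2 * (S / l) = S * l := by field_simp
      have e2 : l ^ 2 * (p / l ^ 2) = p := by field_simp
      rw [e1, e2]
      module
    rw [hQF] at this
    exact sub_eq_zero.1 ((smul_eq_zero.1 this.symm).resolve_left (pow_ne_zero 2 hl))
  have hlim : Tendsto (fun n : ℕ => T ^ n * F) atTop (𝓝 0) := by
    refine tendsto_pi_nhds.2 fun i => tendsto_pi_nhds.2 fun j => ?_
    have hrec : ∀ n : ℕ, (((T ^ (n + 2) * F) i j : ℝ) : ℂ) =
        ((S + w) / 2 / l + (S - w) / 2 / l) * ((T ^ (n + 1) * F) i j : ℝ) -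
          ((S + w) / 2 / l) * ((S - w) / 2 / l) * ((T ^ n * F) i j : ℝ) := by
      intro n
      have e : T ^ (n + 2) * F = (S / l) • (T ^ (n + 1) * F) - (p / l ^ 2) • (T ^ n * F) := by
        rw [pow_add, pow_add, pow_two, pow_one, mul_assoc, mul_assoc, hTF, mul_sub,
          mul_smul_comm, mul_smul_comm, mul_assoc]
      rw [e]
      simp only [Matrix.sub_apply, Matrix.smul_apply, smul_eq_mul]
      push_cast
      have e1 : ((S : ℂ) + w) / 2 / l + (S - w) / 2 / l = S / l := by ring
      have e2 : ((S : ℂ) + w) / 2 / l * ((S - w) / 2 / l) = p / l ^ 2 := by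
        field_simp
        linear_combination -hw
      rw [e1, e2]
    have := tendsto_zero_of_recurrence
      (a := fun n => (((T ^ n * F) i j : ℝ) : ℂ)) hm₁ hm₂ hrec
    have hre := (Complex.continuous_re.tendsto 0).comp this
    simpa only [Function.comp_def, Complex.ofReal_re, Complex.zero_re, Matrix.zero_apply] using hre
  refine ⟨1 - F, ?_⟩
  rw [← hT]
  have hfix : ∀ n : ℕ, T ^ n * (1 - F) = 1 - F := by
    have h1 : T * (1 - F) = 1 - F := by
      rw [hF, sub_sub_cancel, mul_smul_comm, hT, smul_mul_assoc, hMQ, smul_smul l⁻¹,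
        inv_mul_cancel₀ hl, one_smul]
    intro n
    induction n with
    | zero => rw [pow_zero, one_mul]
    | succ n ih => rw [pow_succ, mul_assoc, h1, ih]
  have : (fun n : ℕ => T ^ n) = fun n => (1 - F) + T ^ n * F := by
    funext n
    rw [← hfix n]
    rw [← mul_add, sub_add_cancel, mul_one]
  rw [this]
  simpa using hlim.const_add (1 - F)

/-! ### Local stability. -/

theorem continuous_norm2 : Continuous norm2 := by
  unfold norm2 dotProduct
  fun_prop

theorem continuousAt_toSphere {w : Vec} (hw : w ≠ 0) : ContinuousAt toSphere w := by
  unfold toSphere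
  exact (continuous_norm2.continuousAt.inv₀ (norm2_pos hw).ne').smul continuousAt_id

theorem norm_le_norm2 (w : Vec) : ‖w‖ ≤ norm2 w := by
  refine (pi_norm_le_iff_of_nonneg (Real.sqrt_nonneg _)).2 fun i => ?_
  have e := norm2_sq w
  refine abs_le_of_sq_le_sq ?_ (Real.sqrt_nonneg _)
  change w i ^ 2 ≤ norm2 w ^ 2
  rw [e]
  fin_cases i <;> simp <;> nlinarith [sq_nonneg (w 0), sq_nonneg (w 1), sq_nonneg (w 2)]

theorem exists_mulVec_bound {T : ℕ → Matrix (Fin 3) (Fin 3) ℝ} {E : Matrix (Fin 3) (Fin 3) ℝ}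
    (h : Tendsto T atTop (𝓝 E)) : ∃ C > 0, ∀ n w, ‖T n *ᵥ w‖ ≤ C * ‖w‖ := by
  have h' : Tendsto (fun n i j => T n i j) atTop (𝓝 fun i j => E i j) :=
    tendsto_pi_nhds.2 fun i => tendsto_pi_nhds.2 fun j =>
      tendsto_pi_nhds.1 (tendsto_pi_nhds.1 h i) j
  obtain ⟨K, hK0, hK⟩ := (Metric.isBounded_range_of_tendsto _ h').exists_pos_norm_le
  refine ⟨3 * K, by positivity, fun n w => ?_⟩
  refine (pi_norm_le_iff_of_nonneg (by positivity)).2 fun i => ?_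
  calc ‖(T n *ᵥ w) i‖ = ‖∑ j, T n i j * w j‖ := rfl
    _ ≤ ∑ j : Fin 3, ‖T n i j * w j‖ := norm_sum_le _ _
    _ ≤ ∑ _j : Fin 3, K * ‖w‖ := by
        refine Finset.sum_le_sum fun j _ => ?_
        rw [norm_mul]
        have h1 : ‖T n i j‖ ≤ K :=
          ((norm_le_pi_norm (fun j => T n i j) j).trans
            (norm_le_pi_norm (fun i j => T n i j) i)).trans (hK _ ⟨n, rfl⟩)
        exact mul_le_mul h1 (norm_le_pi_norm w j) (norm_nonneg _) hK0.le
    _ = 3 * K * ‖w‖ := by simp [mul_assoc]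

/-- A periodic orbit in the open cells whose period matrix is the square of a matrix with a
dominating eigenvalue, with one-dimensional eigenspace, is locally stable. -/
theorem isLocallyStableOrbit_of_isDominatingEigenvalue {r l : ℝ} {s : ℕ → Block} {p : ℕ}
    (hp : 0 < p) (hs : ∀ n, s (n + p) = s n) {M : Matrix (Fin 3) (Fin 3) ℝ}
    (hM : prefixProd r s p = M ^ 2) (hl : l ≠ 0) (hd : IsDominatingEigenvalue M l) {u : Vec}
    (hu : M *ᵥ u = l • u) (huniq : ∀ v : Vec, M *ᵥ v = l • v → v = v 0 • u)
    (hcell : ∀ n, prefixProd r s n *ᵥ u ∈ cell r (s n)) :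
    IsLocallyStableOrbit (bMap r) domX (toSphere u) := by
  obtain ⟨E, hE⟩ := hd.exists_tendsto hl
  obtain ⟨T, hT⟩ : ∃ T, T = l⁻¹ • M := ⟨_, rfl⟩
  have hMT : M = l • T := by rw [hT, smul_smul, mul_inv_cancel₀ hl, one_smul]
  rw [← hT] at hE
  obtain ⟨C, hC0, hC⟩ := exists_mulVec_bound hE
  have hu0 : u ≠ 0 := by
    have := ne_zero_of_mem_cell (hcell 0)
    rwa [prefixProd, Matrix.one_mulVec] at this
  obtain ⟨c, hc, ec⟩ := exists_toSphere_eq hu0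
  obtain ⟨a, ha⟩ : ∃ a, a = toSphere u := ⟨_, rfl⟩
  have hTu : T *ᵥ a = a := by
    rw [ha, ec, hT, Matrix.mulVec_smul, Matrix.smul_mulVec, hu, smul_smul l⁻¹ l,
      inv_mul_cancel₀ hl, one_smul]
  have hTa : ∀ n : ℕ, T ^ n *ᵥ a = a := by
    intro n
    induction n with
    | zero => rw [pow_zero, Matrix.one_mulVec]
    | succ n ih => rw [pow_succ, ← Matrix.mulVec_mulVec, hTu, ih]
  have haa : toSphere a = a := by
    rw [ha]
    exact toSphere_eq_self (toSphere_sq hu0)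
  have hcella : ∀ n, prefixProd r s n *ᵥ a ∈ cell r (s n) := by
    intro n
    rw [ha, ec, Matrix.mulVec_smul]
    exact smul_mem_cell (hcell n) hc
  -- Split n into complete periods and a remainder. Each period contributes M² = l²T², so the scalar
  -- is an even power of l and is harmless even though l may be negative.
  have hprod : ∀ (n : ℕ) (w : Vec), prefixProd r s n *ᵥ w =
      (l ^ (2 * (n / p))) • (prefixProd r s (n % p) *ᵥ (T ^ (2 * (n / p)) *ᵥ w)) := by
    intro n w
    nth_rewrite 1 [← Nat.mod_add_div n p]
    rw [prefixProd_add_mul r hs, hM, ← pow_mul, hMT, smul_pow, ← Matrix.mulVec_mulVec,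
      Matrix.smul_mulVec, Matrix.mulVec_smul]
  have hsmod : ∀ n, s (n % p) = s n := fun n => Function.Periodic.map_mod_nat hs n
  have hlpos : ∀ n : ℕ, 0 < l ^ (2 * n) := fun n => by
    rw [pow_mul]
    positivity
  have horbit : ∀ w : Vec, (∀ m : ℕ, ∀ k < p, prefixProd r s k *ᵥ (T ^ (2 * m) *ᵥ w) ∈
      cell r (s k)) → ∀ n, (bMap r)^[n] (toSphere w) =
        toSphere (prefixProd r s (n % p) *ᵥ (T ^ (2 * (n / p)) *ᵥ w)) := by
    intro w hw n
    rw [iterate_bMap_toSphere, hprod, toSphere_smul (hlpos _)]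
    intro n
    rw [hprod, ← hsmod n]
    exact smul_mem_cell (hw _ _ (Nat.mod_lt n hp)) (hlpos _)
  have hcont : ∀ (k : ℕ), Continuous fun w : Vec => prefixProd r s k *ᵥ w := fun k =>
    continuous_const.matrix_mulVec continuous_id
  have hopen : ∀ᶠ w in 𝓝 a, ∀ k < p, prefixProd r s k *ᵥ w ∈ cell r (s k) := by
    have := (Finset.range p).eventually_all (l := 𝓝 a)
      (p := fun k w => prefixProd r s k *ᵥ w ∈ cell r (s k))
    simp only [Finset.mem_range] at this
    exact this.2 fun k _ => ((isOpen_cell r (s k)).preimage (hcont k)).mem_nhds (hcella k)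
  have hconth : ∀ k w, prefixProd r s k *ᵥ w ∈ cell r (s k) →
      ContinuousAt (fun w => toSphere (prefixProd r s k *ᵥ w)) w := fun k w hw =>
    ContinuousAt.comp (f := fun w => prefixProd r s k *ᵥ w)
      (continuousAt_toSphere (ne_zero_of_mem_cell hw)) (hcont k).continuousAt
  have hdist : ∀ v n, ‖T ^ n *ᵥ v - a‖ ≤ C * ‖v - a‖ := by
    intro v n
    nth_rewrite 1 [← hTa n]
    rw [← Matrix.mulVec_sub]
    exact hC n _
  -- The powers of T are uniformly bounded and fix a. Aiming at η/2 leaves room for the limit Ev,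
  -- which satisfies only a non-strict bound.
  have hnear : ∀ P : Vec → Prop, (∀ᶠ w in 𝓝 a, P w) → ∃ δ > 0, ∀ v : Vec, norm2 (v - a) < δ →
      (∀ n, P (T ^ n *ᵥ v)) ∧ P (E *ᵥ v) := by
    intro P hP
    obtain ⟨η, hη, hP⟩ := Metric.eventually_nhds_iff.1 hP
    refine ⟨η / (2 * C), by positivity, fun v hv => ?_⟩
    have hb : ∀ n, ‖T ^ n *ᵥ v - a‖ ≤ η / 2 := by
      intro n
      calc _ ≤ C * ‖v - a‖ := hdist v n
        _ ≤ C * (η / (2 * C)) := by gcongr; exact (norm_le_norm2 _).trans hv.le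
        _ = η / 2 := by field_simp
    have hlim : Tendsto (fun n => T ^ n *ᵥ v) atTop (𝓝 (E *ᵥ v)) :=
      ((continuous_id.matrix_mulVec continuous_const).tendsto E).comp hE
    have hbE : ‖E *ᵥ v - a‖ ≤ η / 2 :=
      le_of_tendsto (hlim.sub_const a).norm (Eventually.of_forall hb)
    refine ⟨fun n => hP ?_, hP ?_⟩
    · rw [dist_eq_norm]
      linarith [hb n]
    · rw [dist_eq_norm]
      linarith
  have hcell' : ∀ m : ℕ, ∀ k < p, prefixProd r s k *ᵥ (T ^ (2 * m) *ᵥ a) ∈ cell r (s k) := by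
    intro m k _
    rw [hTa]
    exact hcella k
  have hit : ∀ n, (bMap r)^[n] a = toSphere (prefixProd r s (n % p) *ᵥ a) := by
    intro n
    have := horbit a hcell' n
    rwa [haa, hTa] at this
  rw [← ha]
  constructor
  · intro ε hε
    have hclose : ∀ᶠ w in 𝓝 a, ∀ k < p, norm2 (toSphere (prefixProd r s k *ᵥ w) -
        toSphere (prefixProd r s k *ᵥ a)) < ε := by
      have := (Finset.range p).eventually_all (l := 𝓝 a)
        (p := fun k w => norm2 (toSphere (prefixProd r s k *ᵥ w) -
          toSphere (prefixProd r s k *ᵥ a)) < ε)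
      simp only [Finset.mem_range] at this
      refine this.2 fun k _ => ?_
      have hc2 : ContinuousAt (fun w => norm2 (toSphere (prefixProd r s k *ᵥ w) -
          toSphere (prefixProd r s k *ᵥ a))) a :=
        continuous_norm2.continuousAt.comp ((hconth k a (hcella k)).sub continuousAt_const)
      refine hc2.eventually_lt continuousAt_const ?_
      simpa [norm2] using hε
    obtain ⟨δ, hδ, h⟩ := hnear _ (hopen.and hclose)
    refine ⟨δ, hδ, fun v hv hva n => ?_⟩
    have h1 := (h v hva).1
    have e := horbit v (fun m k hk => (h1 (2 * m)).1 k hk) n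
    rw [toSphere_eq_self hv.1] at e
    rw [e, hit]
    exact (h1 _).2 _ (Nat.mod_lt n hp)
  · obtain ⟨δ, hδ, h⟩ := hnear _ hopen
    refine ⟨δ, hδ, fun v hv hva => ?_⟩
    obtain ⟨h1, h2⟩ := h v hva
    have hlim : Tendsto (fun n => T ^ n *ᵥ v) atTop (𝓝 (E *ᵥ v)) :=
      ((continuous_id.matrix_mulVec continuous_const).tendsto E).comp hE
    have hTE : T *ᵥ (E *ᵥ v) = E *ᵥ v := by
      have l1 : Tendsto (fun n => T ^ (n + 1) *ᵥ v) atTop (𝓝 (T *ᵥ (E *ᵥ v))) := by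
        have := ((continuous_const.matrix_mulVec continuous_id :
          Continuous fun w : Vec => T *ᵥ w).tendsto _).comp hlim
        refine this.congr fun n => ?_
        simp [pow_succ']
      exact tendsto_nhds_unique l1 (hlim.comp (tendsto_add_atTop_nat 1))
    -- The limit direction is fixed by T, hence on the eigenline, and it lies in the first cone,
    -- hence on the positive ray of u. After normalization it is u itself.
    have hEu := huniq (E *ᵥ v) (by rw [hMT, Matrix.smul_mulVec, hTE])
    have hEpos : 0 < (E *ᵥ v) 0 := by
      have := h2 0 hp
      rw [prefixProd, Matrix.one_mulVec] at this
      exact (pos_of_mem_cell this).1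
    have hlimk : ∀ k, k < p → Tendsto (fun m : ℕ => norm2 (toSphere (prefixProd r s k *ᵥ
        (T ^ (2 * m) *ᵥ v)) - toSphere (prefixProd r s k *ᵥ a))) atTop (𝓝 0) := by
      intro k hk
      have e : toSphere (prefixProd r s k *ᵥ (E *ᵥ v)) = toSphere (prefixProd r s k *ᵥ a) := by
        rw [hEu, ha, ec, Matrix.mulVec_smul, Matrix.mulVec_smul, toSphere_smul hEpos,
          toSphere_smul hc]
      have l2 : Tendsto (fun m : ℕ => T ^ (2 * m) *ᵥ v) atTop (𝓝 (E *ᵥ v)) :=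
        hlim.comp (tendsto_id.const_mul_atTop' two_pos)
      have l3 := ((hconth k _ (h2 k hk)).tendsto.comp l2).sub_const
        (toSphere (prefixProd r s k *ᵥ a))
      have l4 := (continuous_norm2.tendsto _).comp l3
      rw [e, sub_self] at l4
      simpa [norm2, Function.comp_def] using l4
    have e : ∀ n, norm2 ((bMap r)^[n] v - (bMap r)^[n] a) =
        norm2 (toSphere (prefixProd r s (n % p) *ᵥ (T ^ (2 * (n / p)) *ᵥ v)) -
          toSphere (prefixProd r s (n % p) *ᵥ a)) := by
      intro n
      have e := horbit v (fun m k hk => h1 (2 * m) k hk) n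
      rw [toSphere_eq_self hv.1] at e
      rw [e, hit]
    refine tendsto_order.2 ⟨fun b hb => Eventually.of_forall fun n =>
      hb.trans_le (Real.sqrt_nonneg _), fun b hb => ?_⟩
    have hall : ∀ᶠ m : ℕ in atTop, ∀ k < p, norm2 (toSphere (prefixProd r s k *ᵥ
        (T ^ (2 * m) *ᵥ v)) - toSphere (prefixProd r s k *ᵥ a)) < b := by
      have := (Finset.range p).eventually_all (l := (atTop : Filter ℕ))
        (p := fun k m => norm2 (toSphere (prefixProd r s k *ᵥ
          (T ^ (2 * m) *ᵥ v)) - toSphere (prefixProd r s k *ᵥ a)) < b)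
      simp only [Finset.mem_range] at this
      exact this.2 fun k hk => (hlimk k hk).eventually_lt_const hb
    -- Only p phases occur, so convergence along complete periods for each phase gives convergence
    -- of the whole orbit.
    filter_upwards [(Nat.tendsto_div_const_atTop hp.ne').eventually hall] with n hn
    rw [e]
    exact hn _ (Nat.mod_lt n hp)

end FourSpheres

/-! ### The critical coefficient and the periodic orbit: conclusion. -/

theorem mainTheorem1 :
    (∀ r ∈ Ioo (0 : ℝ) 1, ∃! l : ℝ, IsDominatingEigenvalue (reducedMatrix r) l) ∧
    ∃ rc ∈ Ioo (0 : ℝ) 1,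
      (∀ r ∈ Ioo (0 : ℝ) 1,
        (∃ u : Vec, IsDominatingEigenvector (reducedMatrix r) u ∧ alpha r * u 1 - u 0 = 0) ↔
          r = rc) ∧
      |rc - 0.22006978614631047521| < 10 ^ (-20 : ℤ) ∧
      3 - 2 * √2 < rc ∧ 0.1918 < rc ∧
      ∀ r ∈ Ioo rc 1, ∃ u : Vec,
        (∀ u' : Vec, IsDominatingEigenvector (reducedMatrix r) u' ↔ u' = u) ∧
        (∀ v : Vec, GeneratesPattern r pattern132312 v ↔ v = toSphere u) ∧
        CollisionsFollow r pattern132312 (toSphere u) ∧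
        IsLocallyStableOrbit (bMap r) domX (toSphere u) := by
  refine ⟨fun r hr => ?_, ?_⟩
  · obtain ⟨l, h⟩ := exists_isRoot hr.1 hr.2
    exact ⟨-l, h.isDominatingEigenvalue hr.1, fun m hm =>
      (h.isDominatingEigenvalue hr.1).unique hm⟩
  obtain ⟨rc, ⟨hlo, hhi⟩, hrc⟩ := exists_critPoly_eq_zero
  -- The threshold 11/50 lies just below the critical value, so the finer root bounds hold from the
  -- critical value on.
  have hrc0 : 11 / 50 < rc := by norm_num at hlo ⊢; linarith
  have hrc1 : rc < 1 := by norm_num at hhi ⊢; linarith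
  refine ⟨rc, ⟨by linarith, hrc1⟩, fun r hr => ⟨?_, ?_⟩, ?_, ?_, by norm_num; linarith, ?_⟩
  · rintro ⟨u, hu, h1⟩
    obtain ⟨l, h⟩ := exists_isRoot hr.1 hr.2
    obtain ⟨hu, h0⟩ := (isDominatingEigenvector_iff h hr.1).1 hu
    have hc := critPoly_eq_zero_of_eigenvector hr.1 hr.2 h.pos.ne' hu h0 h1
    rcases lt_trichotomy r rc with hlt | heq | hgt
    · linarith [critPoly_lt hr.1 hlt hrc1]
    · exact heq
    · linarith [critPoly_lt (by linarith : 0 < rc) hgt hr.2]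
  · rintro rfl
    obtain ⟨l, h⟩ := exists_isRoot hr.1 hr.2
    have hm := h.margin_eq_zero hrc0 hrc1 hrc
    obtain ⟨u, hu, h0⟩ := h.exists_eigenvector hrc0 hrc1 hm.ge
    refine ⟨u, (isDominatingEigenvector_iff h hr.1).2 ⟨hu, h0⟩, ?_⟩
    have e := (eigenRelations hr.1.ne' hu).ratio
    rw [hm, mul_zero] at e
    exact (mul_eq_zero.1 e).resolve_left (h.sq_sub_pos hrc0).ne'
  · rw [abs_lt]
    norm_num at hlo hhi ⊢
    constructor <;> linarith
  · have : (1.4 : ℝ) < √2 := Real.lt_sqrt_of_sq_lt (by norm_num)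
    linarith
  · intro r hr
    have hr0 : 0 < r := by linarith [hr.1]
    have hr2 : 11 / 50 < r := hrc0.trans hr.1
    have hcrit : critPoly r < 0 := hrc ▸ critPoly_lt (by linarith : 0 < rc) hr.1 hr.2
    obtain ⟨l, h⟩ := exists_isRoot hr0 hr.2
    have hm := h.margin_pos hr2 hr.2 hcrit
    obtain ⟨u, hu, h0⟩ := h.exists_eigenvector hr2 hr.2 hm.le
    refine ⟨u, fun u' => ?_, fun v => ⟨fun hv => ?_, ?_⟩,
      h.collisionsFollow hr2 hr.2 hm hu h0, ?_⟩
    · rw [isDominatingEigenvector_iff h hr0]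
      refine ⟨fun ⟨hu', h0'⟩ => ?_, ?_⟩
      · rw [h.eigenvector_eq hr2 hr.2 hm.le hu h0 hu', h0', one_smul]
      · rintro rfl
        exact ⟨hu, h0⟩
    · exact hv.eq_toSphere h hr2 hr.2 hm.le hu h0
    · rintro rfl
      exact h.generatesPattern hr2 hr.2 hm hu h0
    · exact isLocallyStableOrbit_of_isDominatingEigenvalue (by norm_num) word_add_six
        (prefixProd_six r) (neg_ne_zero.2 h.pos.ne') (h.isDominatingEigenvalue hr0) hu
        (fun v hv => h.eigenvector_eq hr2 hr.2 hm.le hu h0 hv) (h.mem_cell hr2 hr.2 hm hu h0)
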